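/- **Setting.** Let $d,d_1\in\mathbb N$, let $\|\cdot\|$ be any norm on $\mathbb R^d$, and let $\mathcal X\subset\mathbb R^d$ be compact, $\mathcal Z\subseteq\mathbb R^{d_1}$, $\mathcal Y$ a finite set and $F:\mathcal X\times\mathcal Y\to\mathbb R^d$. Let $\beta,n_0>0$, $\mathfrak a\in[0,1)$, $\kappa_1,\kappa_2\in[0,1]$, $\kappa_3\in[0,1)$, $\mathfrak c_1,\dots,\mathfrak c_5>0$, $\mathfrak c_6,\dots,\mathfrak c_9\in\mathbb R$, and $\beta_n=\beta/(n+n_0)^{1-\mathfrak a}$. On a probability space with a filtration $(\mathcal F_n)_{n\ge0}$ consider, for $n\ge 0$, $$x_{n+1}=x_n+\beta_n\bigl(F(x_n,y_n)-x_n+M_{n+1}\bigr),$$ with $x_n\in\mathcal X$, $y_n\in\mathcal Y$, $M_n\in\mathbb R^d$ and controls $\zeta_n\in\mathcal Z$, where $x_n,y_n,M_n$ and the transition matrix $p^{(\zeta_n,x_n)}$ are $\mathcal F_n$-measurable (for instance $\zeta_n$ deterministic and $\mathcal F_n$ generated by $(y_m,x_m,M_m)_{m\le n}$). **Assumptions.**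 1. For each $(\zeta,x)\in\mathcal Z\times\mathcal X$, $p^{(\zeta,x)}$ is an irreducible stochastic matrix on $\mathcal Y$ with stationary distribution $\mu^{(\zeta,x)}$, and $\mathbb P(y_{n+1}=y'\mid\mathcal F_n)=p^{(\zeta_n,x_n)}(y_n,y')$ a.s. for all $n\ge 0$ and $y'\in\mathcal Y$. 2. $\mu_{\min}(\zeta):=\min_{x\in\mathcal X}\min_{i\in\mathcal Y}\mu^{(\zeta,x)}(i)>0$ for all $\zeta\in\mathcal Z$, and there is a state $i^\star\in\mathcal Y$ whose expected hitting time under $p^{(\zeta,x)}$, from any initial state, is at most $\mathfrak c_1/\mu_{\min}(\zeta)$ for all $(\zeta,x)\in\mathcal Z\times\mathcal X$. 3. For all $(\zeta,w)\in\mathcal Z\times\mathcal X$, the map $\bar F^{(\zeta,w)}(x):=\sum_{i\in\mathcal Y}\mu^{(\zeta,w)}(i)F(x,i)$ maps $\mathcal X$ to $\mathcal X$ and satisfies $\|\bar F^{(\zeta,w)}(x)-\bar F^{(\zeta,w)}(z)\|\le\alpha(\zeta)\|x-z\|$ for all $x,z\in\mathcal X$, with $\alpha(\zeta)\in[0,1)$.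 All these maps have the same fixed point $x^\star\in\mathcal X$. Moreover $1-\alpha(\zeta)=\mathfrak c_2\,\mu_{\min}(\zeta)$ for all $\zeta\in\mathcal Z$. 4. A.s. for all $n\ge 0$: $1-\alpha(\zeta_n)\ge \mathfrak c_3/(n+n_0)^{\kappa_1}$, and $\sum_{j}|p^{(\zeta_n,x)}(i,j)-p^{(\zeta_{n+1},x)}(i,j)|\le \mathfrak c_4/(n+n_0)^{1-\kappa_2}$ for all $i\in\mathcal Y$, $x\in\mathcal X$. Moreover $\sum_j|p^{(\zeta,x)}(i,j)-p^{(\zeta,x')}(i,j)|\le L_2(\zeta)\|x-x'\|$ for all $\zeta\in\mathcal Z$, $x,x'\in\mathcal X$, $i\in\mathcal Y$, where a.s. $L_2(\zeta_n)\le\mathfrak c_5(n+n_0)^{\kappa_3}\log(n+n_0)$ for all $n\ge 0$. 5. For all $n\ge 0$: $\mathbb E[M_{n+1}\mid\mathcal F_n]=0$ a.s., and a.s. every coordinate of $M_{n+1}$ is bounded by $\mathfrak c_7$ in absolute value. For $x,x'\in\mathcal X$, $i\in\mathcal Y$ and every coordinate $\ell$: $|[F(x,i)](\ell)-[F(x',i)](\ell)|\le\mathfrak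 c_6\|x-x'\|$, $\|x\|\le\mathfrak c_8$ and $\|F(x,i)\|\le\mathfrak c_9$. 6. $\kappa_1\le\mathfrak a$, $2\mathfrak a+6\kappa_1+3\kappa_3<1$ and $\mathfrak a+6\kappa_1+\kappa_2+2\kappa_3<1$. If $\mathfrak a=0$, then $\beta\ge2(1-2\kappa_1)$. If $\mathfrak a=\kappa_1$, then $\beta\mathfrak c_3$ is at least each of $1-(3\mathfrak a+4\kappa_1+2\kappa_3)$, $2-(4\mathfrak a+6\kappa_1+4\kappa_3)$ and $2-(2\mathfrak a+6\kappa_1+2\kappa_2+2\kappa_3)$. **Theorem.** There are $C>0$ and $k\in\mathbb N$, depending only on $d$, $d_1$, the norm and the constants $\beta,n_0,\mathfrak a,\kappa_1,\kappa_2,\kappa_3,\mathfrak c_1,\dots,\mathfrak c_9$, such that under these assumptions, for every $\delta>0$, with probability at least $1-\frac{\pi^2d}{6}\delta$, simultaneously for all $n\ge1$, $$\|x_n-x^\star\|\le C\,(1+\log n)^k\,\sqrt{\frac{\log(n^2/\delta)}{n}}\;n^{2\kappa_1+\max\{\mathfrak a+\kappa_3,\,\kappa_2\}}.$$ Moreover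 $x_n\to x^\star$ almost surely. (For $\delta\ge 6/(\pi^2 d)$ the first claim is void; otherwise $\log(n^2/\delta)>0$ for all $n\ge1$.) -/

import Mathlib

open MeasureTheory Filter
open scoped Topology

/-- The numerical constants of a contractive Markovian stochastic approximation scheme:
stepsize constants `β, n₀, 𝔞`, rate exponents `κ₁, κ₂, κ₃`, and bounds `c₁, …, c₉`. -/
structure SAConstants where
  (β n₀ 𝔞 κ₁ κ₂ κ₃ c₁ c₂ c₃ c₄ c₅ c₆ c₇ c₈ c₉ : ℝ)

namespace SAConstants

/-- The stepsize `β_n = β / (n + n₀)^(1 - 𝔞)`. -/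
noncomputable def step (K : SAConstants) (n : ℕ) : ℝ :=
  K.β / ((n : ℝ) + K.n₀) ^ (1 - K.𝔞)

/-- Ranges of the constants, and the conditions on the hyperparameters. -/
structure Admissible (K : SAConstants) : Prop where
  β_pos : 0 < K.β
  n₀_pos : 0 < K.n₀
  𝔞_mem : K.𝔞 ∈ Set.Ico (0 : ℝ) 1
  κ₁_mem : K.κ₁ ∈ Set.Icc (0 : ℝ) 1
  κ₂_mem : K.κ₂ ∈ Set.Icc (0 : ℝ) 1
  κ₃_mem : K.κ₃ ∈ Set.Ico (0 : ℝ) 1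
  c₁_pos : 0 < K.c₁
  c₂_pos : 0 < K.c₂
  c₃_pos : 0 < K.c₃
  c₄_pos : 0 < K.c₄
  c₅_pos : 0 < K.c₅
  κ₁_le : K.κ₁ ≤ K.𝔞
  exponents₁ : 2 * K.𝔞 + 6 * K.κ₁ + 3 * K.κ₃ < 1
  exponents₂ : K.𝔞 + 6 * K.κ₁ + K.κ₂ + 2 * K.κ₃ < 1
  of_𝔞_eq_zero : K.𝔞 = 0 → 2 * (1 - 2 * K.κ₁) ≤ K.β
  of_𝔞_eq_κ₁ : K.𝔞 = K.κ₁ →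
    1 - (3 * K.𝔞 + 4 * K.κ₁ + 2 * K.κ₃) ≤ K.β * K.c₃ ∧
    2 - (4 * K.𝔞 + 6 * K.κ₁ + 4 * K.κ₃) ≤ K.β * K.c₃ ∧
    2 - (2 * K.𝔞 + 6 * K.κ₁ + 2 * K.κ₂ + 2 * K.κ₃) ≤ K.β * K.c₃

end SAConstants

section MarkovChain

variable {Y : Type*} [Fintype Y] [DecidableEq Y]

/-- `μ` is a stationary distribution of the transition matrix `p`. -/
def IsStationaryDistribution (p : Matrix Y Y ℝ) (μ : Y → ℝ) : Prop :=
  (∀ i, 0 ≤ μ i) ∧ ∑ i, μ i = 1 ∧ ∀ j, ∑ i, μ i * p i j = μ j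

/-- `survivalProb p s n i` is the probability that the Markov chain with transition matrix `p`
started at `i` has not visited the state `s` at any of the times `0, 1, …, n`. -/
def survivalProb (p : Matrix Y Y ℝ) (s : Y) : ℕ → Y → ℝ
  | 0, i => if i = s then 0 else 1
  | n + 1, i => if i = s then 0 else ∑ j, p i j * survivalProb p s n j

/-- The expected hitting time `E_i[τ] = ∑_{n ≥ 0} P_i(τ > n)` of the state `s` by the Markov
chain with transition matrix `p` started at `i`, where `τ = inf {n ≥ 0 | y_n = s}`. -/
noncomputable def expectedHittingTime (p : Matrix Y Y ℝ) (s i : Y) : ENNReal :=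
  ∑' n, ENNReal.ofReal (survivalProb p s n i)

end MarkovChain

/-- The deterministic data of the scheme in `ℝ^d` with finite chain state space `Y` and controls
in `ℝ^{d₁}`. Values of the functions outside `Z` and `X` are irrelevant. -/
structure SAModel (d d₁ : ℕ) (Y : Type*) where
  /-- the set of iterates -/
  X : Set (Fin d → ℝ)
  /-- the set of controls -/
  Z : Set (Fin d₁ → ℝ)
  /-- the update direction -/
  F : (Fin d → ℝ) → Y → (Fin d → ℝ)
  /-- the transition matrices `p^{(ζ, x)}` -/
  p : (Fin d₁ → ℝ) → (Fin d → ℝ) → Matrix Y Y ℝ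
  /-- the stationary distributions `μ^{(ζ, x)}` -/
  μ : (Fin d₁ → ℝ) → (Fin d → ℝ) → Y → ℝ
  /-- the contraction factors -/
  α : (Fin d₁ → ℝ) → ℝ
  /-- Lipschitz constants of the transition matrices in the iterate -/
  L₂ : (Fin d₁ → ℝ) → ℝ
  /-- the designated state -/
  iStar : Y
  /-- the common fixed point -/
  xStar : Fin d → ℝ

namespace SAModel

variable {d d₁ : ℕ} {Y : Type*} [Fintype Y] [DecidableEq Y]

/-- `μ_min(ζ) = min_{x ∈ X} min_{i ∈ Y} μ^{(ζ, x)}(i)`. -/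
noncomputable def μMin (S : SAModel d d₁ Y) (ζ : Fin d₁ → ℝ) : ℝ :=
  ⨅ q : S.X × Y, S.μ ζ q.1 q.2

/-- The stationary average `F̄^{(ζ, w)}(x) = ∑_i μ^{(ζ, w)}(i) F(x, i)`. -/
def FBar (S : SAModel d d₁ Y) (ζ : Fin d₁ → ℝ) (w x : Fin d → ℝ) : Fin d → ℝ :=
  ∑ i, S.μ ζ w i • S.F x i

/-- The assumptions on the deterministic data; `N` is the norm on `ℝ^d`. -/
structure Assumptions (S : SAModel d d₁ Y) (N : Seminorm ℝ (Fin d → ℝ)) (K : SAConstants) :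
    Prop where
  X_compact : IsCompact S.X
  X_bound : ∀ x ∈ S.X, N x ≤ K.c₈
  F_bound : ∀ x ∈ S.X, ∀ i, N (S.F x i) ≤ K.c₉
  F_lipschitz : ∀ x ∈ S.X, ∀ x' ∈ S.X, ∀ i l, |S.F x i l - S.F x' i l| ≤ K.c₆ * N (x - x')
  p_stochastic : ∀ ζ ∈ S.Z, ∀ x ∈ S.X, S.p ζ x ∈ Matrix.rowStochastic ℝ Y
  p_irreducible : ∀ ζ ∈ S.Z, ∀ x ∈ S.X, (S.p ζ x).IsIrreducible
  μ_stationary : ∀ ζ ∈ S.Z, ∀ x ∈ S.X, IsStationaryDistribution (S.p ζ x) (S.μ ζ x)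
  μMin_pos : ∀ ζ ∈ S.Z, 0 < S.μMin ζ
  hitting : ∀ ζ ∈ S.Z, ∀ x ∈ S.X, ∀ i,
    expectedHittingTime (S.p ζ x) S.iStar i ≤ ENNReal.ofReal (K.c₁ / S.μMin ζ)
  α_mem : ∀ ζ ∈ S.Z, S.α ζ ∈ Set.Ico (0 : ℝ) 1
  FBar_mapsTo : ∀ ζ ∈ S.Z, ∀ w ∈ S.X, Set.MapsTo (S.FBar ζ w) S.X S.X
  FBar_contraction : ∀ ζ ∈ S.Z, ∀ w ∈ S.X, ∀ x ∈ S.X, ∀ z ∈ S.X,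
    N (S.FBar ζ w x - S.FBar ζ w z) ≤ S.α ζ * N (x - z)
  xStar_mem : S.xStar ∈ S.X
  FBar_xStar : ∀ ζ ∈ S.Z, ∀ w ∈ S.X, S.FBar ζ w S.xStar = S.xStar
  one_sub_α : ∀ ζ ∈ S.Z, 1 - S.α ζ = K.c₂ * S.μMin ζ
  p_lipschitz : ∀ ζ ∈ S.Z, ∀ x ∈ S.X, ∀ x' ∈ S.X, ∀ i,
    ∑ j, |S.p ζ x i j - S.p ζ x' i j| ≤ S.L₂ ζ * N (x - x')

/-- `(ζ, x, y, M)` is a run of the scheme on the filtered probability space `(Ω, ℱ, P)`: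
controls `ζ_n`, iterates `x_n`, chain `y_n`, noise `M_n`. -/
structure IsRun (S : SAModel d d₁ Y) (K : SAConstants) {Ω : Type*} [mΩ : MeasurableSpace Ω]
    (P : Measure Ω) (ℱ : Filtration ℕ mΩ) (ζ : ℕ → Ω → (Fin d₁ → ℝ)) (x : ℕ → Ω → (Fin d → ℝ))
    (y : ℕ → Ω → Y) (M : ℕ → Ω → (Fin d → ℝ)) : Prop where
  ζ_mem : ∀ n ω, ζ n ω ∈ S.Z
  x_mem : ∀ n ω, x n ω ∈ S.X
  x_adapted : ∀ n, Measurable[ℱ n] (x n)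
  M_adapted : ∀ n, Measurable[ℱ n] (M n)
  y_adapted : ∀ n i, MeasurableSet[ℱ n] {ω | y n ω = i}
  /-- The control does not anticipate: the transition matrix in force at time `n` is known at
  time `n`. -/
  p_adapted : ∀ n i j, Measurable[ℱ n] fun ω => S.p (ζ n ω) (x n ω) i j
  iteration : ∀ n ω,
    x (n + 1) ω = x n ω + K.step n • (S.F (x n ω) (y n ω) - x n ω + M (n + 1) ω)
  /-- Controlled Markov property: `P(y_{n+1} = j | ℱ_n) = p^{(ζ_n, x_n)}(y_n, j)`. -/
  markov : ∀ n j, P[{ω | y (n + 1) ω = j}.indicator (fun _ => (1 : ℝ)) | ℱ n]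
    =ᵐ[P] fun ω => S.p (ζ n ω) (x n ω) (y n ω) j
  M_bound : ∀ n : ℕ, ∀ᵐ ω ∂P, ∀ l, |M (n + 1) ω l| ≤ K.c₇
  M_martingale_diff : ∀ (n : ℕ) l, P[fun ω => M (n + 1) ω l | ℱ n] =ᵐ[P] 0
  contraction_rate : ∀ n : ℕ, ∀ᵐ ω ∂P, K.c₃ / ((n : ℝ) + K.n₀) ^ K.κ₁ ≤ 1 - S.α (ζ n ω)
  temporal_smoothness : ∀ n : ℕ, ∀ᵐ ω ∂P, ∀ x ∈ S.X, ∀ i,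
    ∑ j, |S.p (ζ n ω) x i j - S.p (ζ (n + 1) ω) x i j|
      ≤ K.c₄ / ((n : ℝ) + K.n₀) ^ (1 - K.κ₂)
  iterate_sensitivity : ∀ n : ℕ, ∀ᵐ ω ∂P,
    S.L₂ (ζ n ω) ≤ K.c₅ * ((n : ℝ) + K.n₀) ^ K.κ₃ * Real.log ((n : ℝ) + K.n₀)

end SAModel

/-!
The iterates average the noise while contracting towards `x⋆`, and the proof separates these two
effects. The Poisson equation `V - p V = F(x, ·) - F̄(x)` of the chain in force at time `n`, with
solution `V_n` vanishing at the designated state, turns the Markovian noise into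

  `F(x_n, y_n) - F̄_n(x_n) = [V_n(y_{n+1}) - (p_n V_n)(y_n)] + [W_n - W_{n+1}] + e_n`,

where `W_n = V_n(y_n)` and `e_n = V_{n+1}(y_{n+1}) - V_n(y_{n+1})`: a martingale difference, a
telescoping part and a drift (`SAModel.IsRun.iteration_eq`). A maximum principle for the chain
killed at the designated state (`abs_le_of_abs_sub_sum_le`) bounds `V_n` by the hitting times, which
are of order `n ^ κ₁`. Applied to a difference of two solutions it bounds `e_n`: the change of the
transition matrix enters times the square of the hitting times, and the change of `F(x, ·)` times
the hitting times (`abs_poissonSol_sub_le`). All these bounds are deterministic.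

The stepsize averages `A_{n+1} = (1 - β_n) A_n + β_n ξ_n` of the martingale differences are
sub-Gaussian with a variance that satisfies a linear recursion (`hasSubgaussianMGF_linearRec`), and a
union bound with failure probability `δ / n ^ 2` per coordinate gives the constant `π² d / 6`
(`SAModel.IsRun.measure_averagedNoise_le`). On the remaining event the shifted iterates
`z_n = x_n - A_n + β_n W_n` satisfy

  `N (z_{n+1} - x⋆) ≤ (1 - β_n (1 - α_n)) N (z_n - x⋆) + β_n · (small terms)`,

because `β_n W_n` swallows the telescoping part up to terms of order `n ^ (-1 + 𝔞 + κ₁)`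
(`SAConstants.IsRate.dist_le`). Both linear recursions, for the variance and for `z_n`, are solved
by one comparison with powers of `n` (`le_mul_rpow_neg_of_recursion`).

This works for every rate `n ^ (-r)` with `r` below explicit thresholds, and the conditions on the
hyperparameters leave room for an `r > 0` that is at least `1/2 - 2 κ₁ - max (𝔞 + κ₃) κ₂`
(`SAConstants.exists_isRate`). The room absorbs the logarithm in the iterate sensitivity, so no
logarithmic factor is needed. As `r` is positive also when the exponent asked for is not, letting
`δ → 0` gives almost sure convergence.
-/

/-! ### The Poisson equation of a finite Markov chain -/

section Poisson

open Matrix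

variable {Y : Type*} [Fintype Y]

theorem IsStationaryDistribution.sum_mul_sub {p : Matrix Y Y ℝ} {μ : Y → ℝ}
    (hμ : IsStationaryDistribution p μ) (g : Y → ℝ) :
    ∑ i, μ i * (g i - ∑ j, p i j * g j) = 0 := by
  have h : ∑ i, μ i * ∑ j, p i j * g j = ∑ j, μ j * g j := by
    simp_rw [Finset.mul_sum]
    rw [Finset.sum_comm]
    refine Finset.sum_congr rfl fun j _ => ?_
    rw [← hμ.2.2 j, Finset.sum_mul]
    exact Finset.sum_congr rfl fun i _ => by ring
  simp_rw [mul_sub, Finset.sum_sub_distrib, h, sub_self]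

theorem IsStationaryDistribution.abs_sum_le {p : Matrix Y Y ℝ} {μ : Y → ℝ}
    (hμ : IsStationaryDistribution p μ) {f : Y → ℝ} {A : ℝ} (hf : ∀ i, |f i| ≤ A) :
    |∑ i, μ i * f i| ≤ A := by
  calc |∑ i, μ i * f i| ≤ ∑ i, |μ i * f i| := Finset.abs_sum_le_sum_abs _ _
    _ ≤ ∑ i, μ i * A := Finset.sum_le_sum fun i _ => by
        rw [abs_mul, abs_of_nonneg (hμ.1 i)]
        exact mul_le_mul_of_nonneg_left (hf i) (hμ.1 i)
    _ = A := by rw [← Finset.sum_mul, hμ.2.1, one_mul]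

variable [DecidableEq Y]

theorem survivalProb_nonneg {p : Matrix Y Y ℝ} (hp : p ∈ rowStochastic ℝ Y) (s : Y) (n : ℕ)
    (i : Y) : 0 ≤ survivalProb p s n i := by
  induction n generalizing i with
  | zero => unfold survivalProb; split_ifs <;> norm_num
  | succ n ih =>
    unfold survivalProb
    split_ifs
    · exact le_rfl
    · exact Finset.sum_nonneg fun j _ => mul_nonneg (nonneg_of_mem_rowStochastic hp) (ih j)

theorem sum_survivalProb_le {p : Matrix Y Y ℝ} (hp : p ∈ rowStochastic ℝ Y) {s i : Y} {H : ℝ}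
    (hH₀ : 0 ≤ H) (hH : expectedHittingTime p s i ≤ ENNReal.ofReal H) (n : ℕ) :
    ∑ m ∈ Finset.range n, survivalProb p s m i ≤ H := by
  have h := (ENNReal.sum_le_tsum (f := fun m => ENNReal.ofReal (survivalProb p s m i))
    (Finset.range n)).trans hH
  rwa [← ENNReal.ofReal_sum_of_nonneg (fun m _ => survivalProb_nonneg hp s m i),
    ENNReal.ofReal_le_ofReal_iff hH₀] at h

theorem tendsto_survivalProb {p : Matrix Y Y ℝ} (hp : p ∈ rowStochastic ℝ Y) {s i : Y} {H : ℝ}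
    (hH₀ : 0 ≤ H) (hH : expectedHittingTime p s i ≤ ENNReal.ofReal H) :
    Tendsto (fun n => survivalProb p s n i) atTop (𝓝 0) :=
  (summable_of_sum_range_le (fun m => survivalProb_nonneg hp s m i)
    (sum_survivalProb_le hp hH₀ hH)).tendsto_atTop_zero

/-- Maximum principle for the chain killed at `s`: a function vanishing at `s` whose image under
`1 - p` is at most `A` off `s` is at most `A` times the expected hitting time of `s`. -/
theorem abs_le_of_abs_sub_sum_le {p : Matrix Y Y ℝ} (hp : p ∈ rowStochastic ℝ Y) {s : Y} {H : ℝ}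
    (hH₀ : 0 ≤ H) (hH : ∀ i, expectedHittingTime p s i ≤ ENNReal.ofReal H) {g : Y → ℝ} {A : ℝ}
    (hA : 0 ≤ A) (hs : g s = 0) (hg : ∀ i, i ≠ s → |g i - ∑ j, p i j * g j| ≤ A) (i : Y) :
    |g i| ≤ A * H := by
  set G : ℝ := ∑ j, |g j| with hG
  -- Unfolding the equation `n` times leaves the part of the chain that has not yet hit `s`.
  have key : ∀ (n : ℕ) (i : Y), |g i| ≤
      A * ∑ m ∈ Finset.range n, survivalProb p s m i + G * survivalProb p s n i := by
    intro n
    induction n with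
    | zero =>
      intro i
      by_cases hi : i = s
      · simp [hi, hs, survivalProb]
      · simpa [hi, survivalProb] using
          Finset.single_le_sum (f := fun j => |g j|) (fun j _ => abs_nonneg _) (Finset.mem_univ i)
    | succ n ih =>
      intro i
      by_cases hi : i = s
      · subst hi
        rw [hs, abs_zero]
        exact add_nonneg
          (mul_nonneg hA (Finset.sum_nonneg fun m _ => survivalProb_nonneg hp i m i))
          (mul_nonneg (Finset.sum_nonneg fun j _ => abs_nonneg _) (survivalProb_nonneg hp i _ i))
      · have h1 : |g i| ≤ A + ∑ j, p i j * |g j| := by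
          have h2 : |∑ j, p i j * g j| ≤ ∑ j, p i j * |g j| := by
            refine (Finset.abs_sum_le_sum_abs _ _).trans_eq (Finset.sum_congr rfl fun j _ => ?_)
            rw [abs_mul, abs_of_nonneg (nonneg_of_mem_rowStochastic hp)]
          have h3 := abs_sub_abs_le_abs_sub (g i) (∑ j, p i j * g j)
          linarith [hg i hi]
        refine h1.trans ?_
        have h4 : ∑ j, p i j * |g j| ≤ ∑ j, p i j *
            (A * ∑ m ∈ Finset.range n, survivalProb p s m j + G * survivalProb p s n j) :=
          Finset.sum_le_sum fun j _ =>
            mul_le_mul_of_nonneg_left (ih j) (nonneg_of_mem_rowStochastic hp)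
        have h5 : ∀ m, survivalProb p s (m + 1) i = ∑ j, p i j * survivalProb p s m j := by
          intro m
          rw [survivalProb, if_neg hi]
        have h6 : ∑ j, p i j *
            (A * ∑ m ∈ Finset.range n, survivalProb p s m j + G * survivalProb p s n j)
            = A * ∑ m ∈ Finset.range n, survivalProb p s (m + 1) i
              + G * survivalProb p s (n + 1) i := by
          simp_rw [h5, mul_add, Finset.sum_add_distrib, Finset.mul_sum]
          congr 1
          · rw [Finset.sum_comm]
            exact Finset.sum_congr rfl fun m _ => Finset.sum_congr rfl fun j _ => by ring
          · exact Finset.sum_congr rfl fun j _ => by ring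
        have h7 : survivalProb p s 0 i = 1 := by rw [survivalProb, if_neg hi]
        rw [Finset.sum_range_succ', h7]
        linarith
  have hlim : Tendsto (fun n => A * H + G * survivalProb p s n i) atTop (𝓝 (A * H + G * 0)) :=
    tendsto_const_nhds.add ((tendsto_survivalProb hp hH₀ (hH i)).const_mul G)
  rw [mul_zero, add_zero] at hlim
  refine ge_of_tendsto' hlim fun n => (key n i).trans ?_
  have := mul_le_mul_of_nonneg_left (sum_survivalProb_le hp hH₀ (hH i) n) hA
  linarith

/-- The matrix of `g ↦ g - p g + g(s) 1`. When `p` has a stationary distribution `μ` and `s` is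
reached in finite expected time it is invertible, and applying `μ` shows that the solution `g` of
`g - p g + g(s) 1 = f` has `g(s) = μ(f)`. -/
def poissonMatrix (p : Matrix Y Y ℝ) (s : Y) : Matrix Y Y ℝ :=
  Matrix.of fun i j => (if i = j then 1 else 0) - p i j + if j = s then 1 else 0

/-- The solution `V` of the Poisson equation `V - p V = f - μ(f)` normalised by `V(s) = 0`. It is
written through a matrix inverse so that it visibly depends measurably on `p` and `f`. -/
noncomputable def poissonSol (p : Matrix Y Y ℝ) (s : Y) (f : Y → ℝ) (i : Y) : ℝ :=
  ((poissonMatrix p s)⁻¹ *ᵥ f) i - ((poissonMatrix p s)⁻¹ *ᵥ f) s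

theorem poissonMatrix_mulVec (p : Matrix Y Y ℝ) (s : Y) (g : Y → ℝ) (i : Y) :
    (poissonMatrix p s *ᵥ g) i = g i - ∑ j, p i j * g j + g s := by
  simp [poissonMatrix, mulVec, dotProduct, add_mul, sub_mul, Finset.sum_add_distrib]

@[simp]
theorem poissonSol_self (p : Matrix Y Y ℝ) (s : Y) (f : Y → ℝ) : poissonSol p s f s = 0 :=
  sub_self _

theorem sum_mul_poissonMatrix_mulVec {p : Matrix Y Y ℝ} {μ : Y → ℝ}
    (hμ : IsStationaryDistribution p μ) (s : Y) (g : Y → ℝ) :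
    ∑ i, μ i * (poissonMatrix p s *ᵥ g) i = g s := by
  simp_rw [poissonMatrix_mulVec, mul_add, Finset.sum_add_distrib, hμ.sum_mul_sub,
    ← Finset.sum_mul, hμ.2.1, one_mul, zero_add]

theorem isUnit_det_poissonMatrix {p : Matrix Y Y ℝ} (hp : p ∈ rowStochastic ℝ Y) {μ : Y → ℝ}
    (hμ : IsStationaryDistribution p μ) {s : Y} {H : ℝ} (hH₀ : 0 ≤ H)
    (hH : ∀ i, expectedHittingTime p s i ≤ ENNReal.ofReal H) :
    IsUnit (poissonMatrix p s).det := by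
  rw [← isUnit_iff_isUnit_det, ← mulVec_injective_iff_isUnit]
  have hinj : ∀ g : Y → ℝ, poissonMatrix p s *ᵥ g = 0 → g = 0 := by
    intro g hg
    have hs : g s = 0 := by
      rw [← sum_mul_poissonMatrix_mulVec hμ s g, hg]
      simp
    funext i
    have h := abs_le_of_abs_sub_sum_le hp hH₀ hH le_rfl hs (fun i _ => ?_) i
    · simpa using h
    · have := congrFun hg i
      rw [poissonMatrix_mulVec, hs, add_zero] at this
      simp [this]
  intro g g' h
  rw [← sub_eq_zero]
  apply hinj
  rw [mulVec_sub]
  exact sub_eq_zero.2 h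

theorem poissonSol_sub_sum {p : Matrix Y Y ℝ} (hp : p ∈ rowStochastic ℝ Y) {μ : Y → ℝ}
    (hμ : IsStationaryDistribution p μ) {s : Y} {H : ℝ} (hH₀ : 0 ≤ H)
    (hH : ∀ i, expectedHittingTime p s i ≤ ENNReal.ofReal H) (f : Y → ℝ) (i : Y) :
    poissonSol p s f i - ∑ j, p i j * poissonSol p s f j = f i - ∑ j, μ j * f j := by
  set g := (poissonMatrix p s)⁻¹ *ᵥ f with hg
  have h1 : poissonMatrix p s *ᵥ g = f := by
    rw [hg, mulVec_mulVec, mul_nonsing_inv _ (isUnit_det_poissonMatrix hp hμ hH₀ hH), one_mulVec]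
  have h2 : ∑ j, μ j * f j = g s := by rw [← sum_mul_poissonMatrix_mulVec hμ s g, h1]
  have h3 : f i = g i - ∑ j, p i j * g j + g s := by rw [← poissonMatrix_mulVec, h1]
  have h4 : ∑ j, p i j * poissonSol p s f j = ∑ j, p i j * g j - g s := by
    simp_rw [poissonSol, ← hg, mul_sub, Finset.sum_sub_distrib, ← Finset.sum_mul,
      sum_row_of_mem_rowStochastic hp, one_mul]
  rw [h4, h2, h3, poissonSol, ← hg]
  ring

theorem abs_poissonSol_le {p : Matrix Y Y ℝ} (hp : p ∈ rowStochastic ℝ Y) {μ : Y → ℝ}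
    (hμ : IsStationaryDistribution p μ) {s : Y} {H : ℝ} (hH₀ : 0 ≤ H)
    (hH : ∀ i, expectedHittingTime p s i ≤ ENNReal.ofReal H) {f : Y → ℝ} {A : ℝ}
    (hf : ∀ i, |f i| ≤ A) (i : Y) : |poissonSol p s f i| ≤ 2 * A * H := by
  have hA : 0 ≤ A := (abs_nonneg _).trans (hf i)
  refine abs_le_of_abs_sub_sum_le hp hH₀ hH (by positivity) (poissonSol_self p s f)
    (fun i _ => ?_) i
  rw [poissonSol_sub_sum hp hμ hH₀ hH]
  linarith [abs_sub (f i) (∑ j, μ j * f j), hf i, hμ.abs_sum_le hf]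

/-- Perturbation bound for the Poisson equation in the chain and in the right-hand side. The
difference of two solutions solves a Poisson equation for the first chain, whose right-hand side
is controlled by the differences of the data. -/
theorem abs_poissonSol_sub_le {p p' : Matrix Y Y ℝ} (hp : p ∈ rowStochastic ℝ Y)
    (hp' : p' ∈ rowStochastic ℝ Y) {μ μ' : Y → ℝ} (hμ : IsStationaryDistribution p μ)
    (hμ' : IsStationaryDistribution p' μ') {s : Y} {H H' : ℝ} (hH₀ : 0 ≤ H) (hH₀' : 0 ≤ H')
    (hH : ∀ i, expectedHittingTime p s i ≤ ENNReal.ofReal H)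
    (hH' : ∀ i, expectedHittingTime p' s i ≤ ENNReal.ofReal H') {f f' : Y → ℝ} {A D E : ℝ}
    (hf : ∀ i, |f' i| ≤ A) (hD : ∀ i, |f i - f' i| ≤ D) (hE : ∀ i, ∑ j, |p i j - p' i j| ≤ E)
    (i : Y) :
    |poissonSol p s f i - poissonSol p' s f' i| ≤ (2 * D + 2 * (E * (2 * A * H'))) * H := by
  have hA : 0 ≤ A := (abs_nonneg _).trans (hf i)
  have hD₀ : 0 ≤ D := (abs_nonneg _).trans (hD i)
  have hE₀ : 0 ≤ E := (Finset.sum_nonneg fun j _ => abs_nonneg _).trans (hE i)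
  set V := poissonSol p s f with hV
  set V' := poissonSol p' s f' with hV'
  have hb : ∀ j, |V' j| ≤ 2 * A * H' := abs_poissonSol_le hp' hμ' hH₀' hH' hf
  have hdiff : ∀ i, |∑ j, (p i j - p' i j) * V' j| ≤ E * (2 * A * H') := by
    intro i
    calc |∑ j, (p i j - p' i j) * V' j| ≤ ∑ j, |(p i j - p' i j) * V' j| :=
          Finset.abs_sum_le_sum_abs _ _
      _ ≤ ∑ j, |p i j - p' i j| * (2 * A * H') := Finset.sum_le_sum fun j _ => by
          rw [abs_mul]
          exact mul_le_mul_of_nonneg_left (hb j) (abs_nonneg _)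
      _ ≤ E * (2 * A * H') := by
          rw [← Finset.sum_mul]
          exact mul_le_mul_of_nonneg_right (hE i) (by positivity)
  have hP : ∀ i, V i - ∑ j, p i j * V j = f i - ∑ j, μ j * f j :=
    poissonSol_sub_sum hp hμ hH₀ hH f
  have hP' : ∀ i, V' i - ∑ j, p' i j * V' j = f' i - ∑ j, μ' j * f' j :=
    poissonSol_sub_sum hp' hμ' hH₀' hH' f'
  have hsplit : ∀ i, ∑ j, (p i j - p' i j) * V' j = ∑ j, p i j * V' j - ∑ j, p' i j * V' j := by
    intro i
    simp_rw [sub_mul, Finset.sum_sub_distrib]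
  -- The two stationary averages of `f'` differ by `μ ((p - p') V')`.
  have hmean : ∑ j, μ j * f' j - ∑ j, μ' j * f' j = ∑ i, μ i * ∑ j, (p i j - p' i j) * V' j := by
    have h1 : ∑ i, μ i * (f' i - ∑ j, μ' j * f' j) = ∑ j, μ j * f' j - ∑ j, μ' j * f' j := by
      simp_rw [mul_sub, Finset.sum_sub_distrib, ← Finset.sum_mul, hμ.2.1, one_mul]
    rw [← h1, ← sub_zero (∑ i, μ i * (f' i - ∑ j, μ' j * f' j)), ← hμ.sum_mul_sub V',
      ← Finset.sum_sub_distrib]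
    refine Finset.sum_congr rfl fun i _ => ?_
    rw [← hP' i, hsplit]
    ring
  refine abs_le_of_abs_sub_sum_le hp hH₀ hH (g := fun i => V i - V' i) (by positivity)
    (by simp [hV, hV']) (fun i _ => ?_) i
  have heq : (V i - V' i) - ∑ j, p i j * (V j - V' j)
      = (f i - f' i) - ∑ j, μ j * (f j - f' j)
        - ∑ i, μ i * ∑ j, (p i j - p' i j) * V' j + ∑ j, (p i j - p' i j) * V' j := by
    have h1 : ∑ j, p i j * (V j - V' j) = ∑ j, p i j * V j - ∑ j, p i j * V' j := by
      simp_rw [mul_sub, Finset.sum_sub_distrib]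
    have h2 : ∑ j, μ j * (f j - f' j) = ∑ j, μ j * f j - ∑ j, μ j * f' j := by
      simp_rw [mul_sub, Finset.sum_sub_distrib]
    rw [← hmean, hsplit, h1, h2]
    linarith [hP i, hP' i]
  rw [heq]
  have b1 := abs_le.1 (hD i)
  have b2 := abs_le.1 (hμ.abs_sum_le hD)
  have b3 := abs_le.1 (hμ.abs_sum_le hdiff)
  have b4 := abs_le.1 (hdiff i)
  rw [abs_le]
  constructor <;> linarith

theorem measurable_poissonSol {Ω : Type*} [MeasurableSpace Ω] {p : Ω → Matrix Y Y ℝ} (s : Y)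
    {f : Ω → Y → ℝ} (hp : ∀ i j, Measurable fun ω => p ω i j) (hf : ∀ i, Measurable fun ω => f ω i)
    (i : Y) : Measurable fun ω => poissonSol (p ω) s (f ω) i := by
  have hdet : ∀ B : Ω → Matrix Y Y ℝ, (∀ i j, Measurable fun ω => B ω i j) →
      Measurable fun ω => (B ω).det := by
    intro B hB
    simp_rw [det_apply]
    exact Finset.measurable_sum _ fun σ _ =>
      (Finset.measurable_prod _ fun i _ => hB _ _).const_smul _
  have hB : ∀ i j, Measurable fun ω => poissonMatrix (p ω) s i j := by
    intro i j
    simp only [poissonMatrix, of_apply]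
    exact (measurable_const.sub (hp i j)).add measurable_const
  have hinv : ∀ i j, Measurable fun ω => (poissonMatrix (p ω) s)⁻¹ i j := by
    intro i j
    simp_rw [inv_def, Matrix.smul_apply, Ring.inverse_eq_inv', adjugate_apply, smul_eq_mul]
    refine (hdet _ hB).inv.mul (hdet _ fun k l => ?_)
    simp_rw [updateRow_apply]
    split_ifs
    · exact measurable_const
    · exact hB k l
  have hvec : ∀ i, Measurable fun ω => ((poissonMatrix (p ω) s)⁻¹ *ᵥ f ω) i := fun i =>
    Finset.measurable_sum _ fun j _ => (hinv i j).mul (hf j)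
  exact (hvec i).sub (hvec s)

end Poisson

/-! ### Recursions with polynomial weights -/

theorem one_sub_div_mul_rpow_neg_le {w r : ℝ} (hw : 0 < w) (hr : 0 ≤ r) :
    (1 - r / w) * w ^ (-r) ≤ (w + 1) ^ (-r) := by
  have hlog : Real.log ((w + 1) / w) ≤ 1 / w := by
    have h := Real.log_le_sub_one_of_pos (show 0 < (w + 1) / w by positivity)
    have h2 : (w + 1) / w - 1 = 1 / w := by field_simp; ring
    linarith
  have hexp : 1 - r / w ≤ ((w + 1) / w) ^ (-r) := by
    rw [Real.rpow_def_of_pos (by positivity)]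
    have h1 := Real.add_one_le_exp (Real.log ((w + 1) / w) * -r)
    have h2 : Real.log ((w + 1) / w) * r ≤ 1 / w * r := mul_le_mul_of_nonneg_right hlog hr
    have h3 : r / w = 1 / w * r := by ring
    linarith
  calc (1 - r / w) * w ^ (-r) ≤ ((w + 1) / w) ^ (-r) * w ^ (-r) :=
        mul_le_mul_of_nonneg_right hexp (Real.rpow_nonneg hw.le _)
    _ = (w + 1) ^ (-r) := by
        rw [← Real.mul_rpow (by positivity) hw.le, div_mul_cancel₀ _ hw.ne']

/-- A recursion that contracts with weights `γ n`, driven by an error of order `(n + n₀) ^ (-r)`,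
stays of that order as soon as the contraction beats the decay `r / (n + n₀)` of the target. -/
theorem le_mul_rpow_neg_of_recursion {n₀ r R B ε : ℝ} (hn₀ : 0 < n₀) (hr : 0 ≤ r)
    (hB : 0 ≤ B) (hRB : R ≤ ε * B) {n₁ T : ℕ} {u γ : ℕ → ℝ}
    (hγ₁ : ∀ n, n₁ ≤ n → γ n ≤ 1) (hγ₀ : ∀ n, n₁ ≤ n → 0 ≤ γ n)
    (hγ : ∀ n, n₁ ≤ n → r / (n + n₀) ≤ (1 - ε) * γ n)
    (hu₁ : u n₁ ≤ B * (n₁ + n₀) ^ (-r))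
    (hu : ∀ n, n₁ ≤ n → n < T →
      u (n + 1) ≤ (1 - γ n) * u n + γ n * (R * ((n : ℝ) + n₀) ^ (-r))) :
    ∀ n, n₁ ≤ n → n ≤ T → u n ≤ B * ((n : ℝ) + n₀) ^ (-r) := by
  intro n hn
  induction n, hn using Nat.le_induction with
  | base => exact fun _ => hu₁
  | succ n hn ih =>
    intro hnT
    have hw : 0 < (n : ℝ) + n₀ := by positivity
    have hwr : 0 ≤ ((n : ℝ) + n₀) ^ (-r) := Real.rpow_nonneg hw.le _
    have h1 := mul_le_mul_of_nonneg_left (ih (by omega)) (sub_nonneg.2 (hγ₁ n hn))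
    have h2 := mul_le_mul_of_nonneg_left (mul_le_mul_of_nonneg_right hRB hwr) (hγ₀ n hn)
    have h3 := mul_le_mul_of_nonneg_left (one_sub_div_mul_rpow_neg_le hw hr) hB
    have h4 := mul_le_mul_of_nonneg_right (hγ n hn) (mul_nonneg hB hwr)
    have h5 : ((n + 1 : ℕ) : ℝ) + n₀ = (n : ℝ) + n₀ + 1 := by push_cast; ring
    rw [h5]
    nlinarith [hu n hn (by omega)]

theorem tendsto_natCast_add_atTop (n₀ : ℝ) : Tendsto (fun n : ℕ => (n : ℝ) + n₀) atTop atTop :=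
  tendsto_atTop_add_const_right _ _ tendsto_natCast_atTop_atTop

/-- Contraction weights `g (n + n₀) ^ (-θ)` beat the decay `r / (n + n₀)` with room to spare if
`θ < 1`, or if `θ = 1` and `r < g`. -/
theorem exists_eventually_div_le {n₀ r g θ : ℝ} (hr : 0 ≤ r) (hg : 0 < g) (hθ : θ ≤ 1)
    (hθ₁ : θ = 1 → r < g) (hn₀ : 0 < n₀) :
    ∃ ε : ℝ, 0 < ε ∧ ε ≤ 1 ∧ ∀ᶠ n : ℕ in atTop,
      r / ((n : ℝ) + n₀) ≤ (1 - ε) * (g * ((n : ℝ) + n₀) ^ (-θ)) := by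
  rcases hθ.lt_or_eq with h | h
  · refine ⟨1 / 2, by norm_num, by norm_num, ?_⟩
    have ht : Tendsto (fun n : ℕ => ((n : ℝ) + n₀) ^ (1 - θ)) atTop atTop :=
      (tendsto_rpow_atTop (by linarith)).comp (tendsto_natCast_add_atTop n₀)
    filter_upwards [ht.eventually_ge_atTop (2 * r / g)] with n hn
    have hw : 0 < (n : ℝ) + n₀ := by positivity
    rw [div_le_iff₀ hw]
    have h1 : ((n : ℝ) + n₀) ^ (1 - θ) = ((n : ℝ) + n₀) ^ (-θ) * ((n : ℝ) + n₀) := by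
      rw [← Real.rpow_add_one hw.ne']
      congr 1
      ring
    rw [div_le_iff₀ hg, h1] at hn
    linarith
  · have hrg := hθ₁ h
    refine ⟨1 - r / g, by rw [sub_pos, div_lt_one hg]; exact hrg,
      by linarith [div_nonneg hr hg.le], .of_forall fun n => le_of_eq ?_⟩
    have hw : 0 < (n : ℝ) + n₀ := by positivity
    rw [h, Real.rpow_neg_one]
    field_simp
    ring

/-! ### Seminorms on `ℝ^d` against the sup norm -/

theorem Seminorm.exists_le_mul_norm {d : ℕ} (N : Seminorm ℝ (Fin d → ℝ)) :
    ∃ C : ℝ, 0 < C ∧ ∀ v, N v ≤ C * ‖v‖ := by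
  refine ⟨1 + ∑ l, N (Pi.single l 1), ?_, fun v => ?_⟩
  · have : 0 ≤ ∑ l : Fin d, N (Pi.single l 1) := Finset.sum_nonneg fun l _ => apply_nonneg N _
    linarith
  · have hv : v = ∑ l, v l • (Pi.single l 1 : Fin d → ℝ) := by
      funext k
      simp [Finset.sum_apply, Pi.single_apply]
    have h1 : N v ≤ ∑ l, ‖v l‖ * N (Pi.single l 1) := by
      conv_lhs => rw [hv]
      refine (Finset.le_sum_of_subadditive N (map_zero N).le (map_add_le_add N) _ _).trans_eq ?_
      exact Finset.sum_congr rfl fun l _ => map_smul_eq_mul N _ _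
    have h2 : ∑ l, ‖v l‖ * N (Pi.single l 1) ≤ ∑ l, ‖v‖ * N (Pi.single l 1) :=
      Finset.sum_le_sum fun l _ =>
        mul_le_mul_of_nonneg_right (norm_le_pi_norm v l) (apply_nonneg N _)
    rw [← Finset.mul_sum] at h2
    nlinarith [norm_nonneg v]

theorem Seminorm.exists_norm_le_mul {d : ℕ} (N : Seminorm ℝ (Fin d → ℝ))
    (hN : ∀ v, N v = 0 → v = 0) : ∃ C : ℝ, 0 < C ∧ ∀ v, ‖v‖ ≤ C * N v := by
  obtain ⟨C, hC, hNC⟩ := N.exists_le_mul_norm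
  have hcont : Continuous N := by
    refine LipschitzWith.continuous (K := C.toNNReal) (LipschitzWith.of_dist_le_mul fun v w => ?_)
    rw [Real.coe_toNNReal _ hC.le, dist_eq_norm, dist_eq_norm, Real.norm_eq_abs]
    exact (abs_sub_map_le_sub N v w).trans (hNC _)
  rcases (Metric.sphere (0 : Fin d → ℝ) 1).eq_empty_or_nonempty with h | h
  · refine ⟨1, one_pos, fun v => ?_⟩
    by_cases hv : v = 0
    · simp [hv]
    · exfalso
      have : ‖v‖⁻¹ • v ∈ Metric.sphere (0 : Fin d → ℝ) 1 := by
        simp [norm_smul, norm_ne_zero_iff.2 hv]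
      simp [h] at this
  · obtain ⟨w, hw, hmin⟩ := (isCompact_sphere (0 : Fin d → ℝ) 1).exists_isMinOn h hcont.continuousOn
    have hw1 : ‖w‖ = 1 := by simpa using hw
    have hNw : 0 < N w := by
      refine lt_of_le_of_ne (apply_nonneg N w) fun h0 => ?_
      rw [hN w h0.symm, norm_zero] at hw1
      exact zero_ne_one hw1
    refine ⟨(N w)⁻¹, inv_pos.2 hNw, fun v => ?_⟩
    by_cases hv : v = 0
    · simp [hv]
    · have hv0 : 0 < ‖v‖ := norm_pos_iff.2 hv
      have h1 : N w ≤ N (‖v‖⁻¹ • v) := hmin (by simp [norm_smul, hv0.ne'])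
      rw [map_smul_eq_mul, norm_inv, norm_norm, inv_mul_eq_div, le_div_iff₀ hv0] at h1
      rw [inv_mul_eq_div, le_div_iff₀ hNw]
      linarith

/-! ### Sub-Gaussian linear recursions driven by bounded martingale differences -/

section Subgaussian

variable {Ω : Type*}

/-- The solution of `A (n + 1) = a n * A n + c n * X n` with `A 0 = 0`. -/
def linearRec (a c : ℕ → ℝ) (X : ℕ → Ω → ℝ) : ℕ → Ω → ℝ
  | 0, _ => 0
  | n + 1, ω => a n * linearRec a c X n ω + c n * X n ω

/-- The variance proxy of `linearRec a c X` when `X n` is a martingale difference bounded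
by `b n`. -/
def linearRecVar (a c b : ℕ → ℝ) : ℕ → ℝ
  | 0 => 0
  | n + 1 => a n ^ 2 * linearRecVar a c b n + (c n * b n) ^ 2

theorem linearRecVar_nonneg (a c b : ℕ → ℝ) (n : ℕ) : 0 ≤ linearRecVar a c b n := by
  cases n with
  | zero => exact le_rfl
  | succ n =>
    have := linearRecVar_nonneg a c b n
    rw [linearRecVar]
    positivity

theorem exp_mul_le_cosh_add_sinh {b x : ℝ} (t : ℝ) (hx : |x| ≤ b) :
    Real.exp (t * x) ≤ Real.cosh (t * b) + Real.sinh (t * b) / b * x := by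
  rcases ((abs_nonneg x).trans hx).eq_or_lt with hb | hb
  · have hx0 : x = 0 := by rw [← hb] at hx; exact abs_eq_zero.1 (le_antisymm hx (abs_nonneg x))
    simp [hx0, ← hb]
  · have hx' := abs_le.1 hx
    have h1 : 0 ≤ (1 + x / b) / 2 := by
      have : -1 ≤ x / b := by rw [le_div_iff₀ hb]; linarith
      linarith
    have h2 : 0 ≤ (1 - x / b) / 2 := by
      have : x / b ≤ 1 := by rw [div_le_iff₀ hb]; linarith
      linarith
    have h := convexOn_exp.2 (Set.mem_univ (t * b)) (Set.mem_univ (-(t * b))) h1 h2 (by ring)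
    have h3 : ((1 + x / b) / 2) • (t * b) + ((1 - x / b) / 2) • (-(t * b)) = t * x := by
      simp only [smul_eq_mul]
      field_simp
      ring
    rw [h3] at h
    refine h.trans_eq ?_
    rw [Real.cosh_eq, Real.sinh_eq, smul_eq_mul, smul_eq_mul]
    ring

theorem integral_mul_eq_zero_of_condExp {m mΩ : MeasurableSpace Ω}
    {P : Measure Ω} [IsProbabilityMeasure P] (hm : m ≤ mΩ) {Z X : Ω → ℝ}
    (hZ : StronglyMeasurable[m] Z) {B : ℝ}
    (hZB : ∀ᵐ ω ∂P, ‖Z ω‖ ≤ B) (hX : Integrable X P) (hX₀ : P[X | m] =ᵐ[P] 0) :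
    ∫ ω, Z ω * X ω ∂P = 0 := by
  have h := condExp_stronglyMeasurable_mul_of_bound hm hZ hX B hZB
  calc ∫ ω, Z ω * X ω ∂P = ∫ ω, (P[Z * X | m]) ω ∂P := (integral_condExp hm).symm
    _ = ∫ _, (0 : ℝ) ∂P := integral_congr_ae (by
        filter_upwards [h, hX₀] with ω h1 h2
        simp [h1, h2])
    _ = 0 := by simp

/-- One step of the Azuma–Hoeffding argument. -/
theorem integral_mul_exp_le {m mΩ : MeasurableSpace Ω}
    {P : Measure Ω} [IsProbabilityMeasure P] (hm : m ≤ mΩ) {Z X : Ω → ℝ}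
    (hZ : StronglyMeasurable[m] Z)
    (hZ₀ : 0 ≤ Z) {B : ℝ} (hZB : ∀ᵐ ω ∂P, ‖Z ω‖ ≤ B) (hXm : AEStronglyMeasurable X P) {b : ℝ}
    (hXb : ∀ᵐ ω ∂P, |X ω| ≤ b) (hX₀ : P[X | m] =ᵐ[P] 0) (t : ℝ) :
    ∫ ω, Z ω * Real.exp (t * X ω) ∂P ≤ Real.exp (t ^ 2 * b ^ 2 / 2) * ∫ ω, Z ω ∂P := by
  have hX : Integrable X P := .of_bound hXm b (by simpa using hXb)
  have hZi : Integrable Z P := .of_bound (hZ.mono hm).aestronglyMeasurable B hZB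
  have hZX : Integrable (fun ω => Z ω * X ω) P :=
    hX.bdd_mul (hZ.mono hm).aestronglyMeasurable hZB
  set u := Real.cosh (t * b)
  set v := Real.sinh (t * b) / b
  calc ∫ ω, Z ω * Real.exp (t * X ω) ∂P ≤ ∫ ω, (u * Z ω + v * (Z ω * X ω)) ∂P := by
        refine integral_mono_of_nonneg (.of_forall fun ω => ?_)
          ((hZi.const_mul u).add (hZX.const_mul v)) ?_
        · exact mul_nonneg (hZ₀ ω) (Real.exp_pos _).le
        · filter_upwards [hXb] with ω hω
          have := mul_le_mul_of_nonneg_left (exp_mul_le_cosh_add_sinh t hω) (hZ₀ ω)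
          refine this.trans_eq ?_
          ring
    _ = u * ∫ ω, Z ω ∂P := by
        rw [integral_add (hZi.const_mul u) (hZX.const_mul v), integral_const_mul,
          integral_const_mul, integral_mul_eq_zero_of_condExp hm hZ hZB hX hX₀, mul_zero, add_zero]
    _ ≤ Real.exp (t ^ 2 * b ^ 2 / 2) * ∫ ω, Z ω ∂P := by
        refine mul_le_mul_of_nonneg_right ?_ (integral_nonneg hZ₀)
        have := Real.cosh_le_exp_half_sq (t * b)
        rwa [mul_pow] at this

variable {mΩ : MeasurableSpace Ω}

theorem stronglyMeasurable_linearRec {ℱ : Filtration ℕ mΩ} (a c : ℕ → ℝ) {X : ℕ → Ω → ℝ}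
    (hX : ∀ n, StronglyMeasurable[ℱ (n + 1)] (X n)) (n : ℕ) :
    StronglyMeasurable[ℱ n] (linearRec a c X n) := by
  induction n with
  | zero => exact stronglyMeasurable_const
  | succ n ih =>
    exact ((ih.mono (ℱ.mono n.le_succ)).const_mul (a n)).add ((hX n).const_mul (c n))

theorem exists_abs_linearRec_le {P : Measure Ω} (a c : ℕ → ℝ) {b : ℕ → ℝ} {X : ℕ → Ω → ℝ}
    (hXb : ∀ n, ∀ᵐ ω ∂P, |X n ω| ≤ b n) (n : ℕ) :
    ∃ B : ℝ, ∀ᵐ ω ∂P, |linearRec a c X n ω| ≤ B := by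
  induction n with
  | zero => exact ⟨0, .of_forall fun ω => by simp [linearRec]⟩
  | succ n ih =>
    obtain ⟨B, hB⟩ := ih
    refine ⟨|a n| * B + |c n| * b n, ?_⟩
    filter_upwards [hB, hXb n] with ω h1 h2
    rw [linearRec]
    refine (abs_add_le _ _).trans ?_
    rw [abs_mul, abs_mul]
    gcongr

/-- Azuma–Hoeffding for linear recursions. -/
theorem hasSubgaussianMGF_linearRec {P : Measure Ω} [IsProbabilityMeasure P]
    {ℱ : Filtration ℕ mΩ} (a c : ℕ → ℝ) {b : ℕ → ℝ} {X : ℕ → Ω → ℝ}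
    (hX : ∀ n, StronglyMeasurable[ℱ (n + 1)] (X n)) (hXb : ∀ n, ∀ᵐ ω ∂P, |X n ω| ≤ b n)
    (hX₀ : ∀ n, P[X n | ℱ n] =ᵐ[P] 0) (n : ℕ) :
    ProbabilityTheory.HasSubgaussianMGF (linearRec a c X n)
      (linearRecVar a c b n).toNNReal P := by
  have hexp : ∀ (n : ℕ) (t : ℝ), ∃ B : ℝ,
      ∀ᵐ ω ∂P, ‖Real.exp (t * linearRec a c X n ω)‖ ≤ B := by
    intro n t
    obtain ⟨B, hB⟩ := exists_abs_linearRec_le a c hXb n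
    refine ⟨Real.exp (|t| * B), ?_⟩
    filter_upwards [hB] with ω hω
    rw [Real.norm_eq_abs, Real.abs_exp, Real.exp_le_exp]
    refine (le_abs_self _).trans ?_
    rw [abs_mul]
    gcongr
  have hmeas : ∀ (n : ℕ) (t : ℝ),
      StronglyMeasurable[ℱ n] fun ω => Real.exp (t * linearRec a c X n ω) := fun n t =>
    Real.continuous_exp.comp_stronglyMeasurable
      ((stronglyMeasurable_linearRec a c hX n).const_mul t)
  refine ⟨fun t => ?_, fun t => ?_⟩
  · obtain ⟨B, hB⟩ := hexp n t
    exact .of_bound ((hmeas n t).mono (ℱ.le n)).aestronglyMeasurable B hB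
  · rw [Real.coe_toNNReal _ (linearRecVar_nonneg a c b n)]
    induction n generalizing t with
    | zero => simp [linearRec, linearRecVar, ProbabilityTheory.mgf]
    | succ n ih =>
      obtain ⟨B, hB⟩ := hexp n (t * a n)
      have h := integral_mul_exp_le (ℱ.le n) (hmeas n (t * a n)) (fun ω => (Real.exp_pos _).le) hB
        ((hX n).mono (ℱ.le _)).aestronglyMeasurable (hXb n) (hX₀ n) (t * c n)
      have heq : ProbabilityTheory.mgf (linearRec a c X (n + 1)) P t
          = ∫ ω, Real.exp (t * a n * linearRec a c X n ω) * Real.exp (t * c n * X n ω) ∂P := by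
        refine integral_congr_ae (.of_forall fun ω => ?_)
        simp only [linearRec]
        rw [← Real.exp_add]
        congr 1
        ring
      rw [heq]
      refine h.trans ((mul_le_mul_of_nonneg_left (ih (t * a n)) (Real.exp_pos _).le).trans_eq ?_)
      rw [← Real.exp_add, linearRecVar]
      congr 1
      ring

theorem measure_lt_abs_le_of_hasSubgaussianMGF {P : Measure Ω} [IsProbabilityMeasure P]
    {A : Ω → ℝ} {s : NNReal} (hA : ProbabilityTheory.HasSubgaussianMGF A s P) {σ L : ℝ}
    (hσ : 0 < σ) (hs : s ≤ σ) (hL : 0 ≤ L) :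
    P {ω | Real.sqrt (2 * σ * L) < |A ω|} ≤ ENNReal.ofReal (2 * Real.exp (-L)) := by
  have hσ' : ProbabilityTheory.HasSubgaussianMGF A σ.toNNReal P := by
    refine ⟨hA.integrable_exp_mul, fun t => (hA.mgf_le t).trans (Real.exp_le_exp.2 ?_)⟩
    rw [Real.coe_toNNReal _ hσ.le]
    gcongr
  have hexp : Real.exp (-Real.sqrt (2 * σ * L) ^ 2 / (2 * (σ.toNNReal : ℝ)))
      = Real.exp (-L) := by
    rw [Real.sq_sqrt (by positivity), Real.coe_toNNReal _ hσ.le]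
    congr 1
    field_simp
  have h1 := hσ'.measure_ge_le (Real.sqrt_nonneg (2 * σ * L))
  have h2 := hσ'.neg.measure_ge_le (Real.sqrt_nonneg (2 * σ * L))
  rw [hexp] at h1 h2
  have hsub : {ω | Real.sqrt (2 * σ * L) < |A ω|} ⊆
      {ω | Real.sqrt (2 * σ * L) ≤ A ω} ∪ {ω | Real.sqrt (2 * σ * L) ≤ (-A) ω} := by
    intro ω hω
    rcases lt_abs.1 (show Real.sqrt (2 * σ * L) < |A ω| from hω) with h | h
    · exact Or.inl h.le
    · exact Or.inr h.le
  have h3 := (measureReal_mono (μ := P) hsub).trans (measureReal_union_le _ _)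
  rw [← ofReal_measureReal]
  exact ENNReal.ofReal_le_ofReal (by linarith)

end Subgaussian

/-! ### Choice of the rate -/

namespace SAConstants

theorem step_eq (K : SAConstants) (hK : K.Admissible) (n : ℕ) :
    K.step n = K.β * ((n : ℝ) + K.n₀) ^ (-(1 - K.𝔞)) := by
  have hw : 0 ≤ (n : ℝ) + K.n₀ := add_nonneg n.cast_nonneg hK.n₀_pos.le
  rw [step, Real.rpow_neg hw, div_eq_mul_inv]

theorem step_pos (K : SAConstants) (hK : K.Admissible) (n : ℕ) : 0 < K.step n := by
  have := hK.n₀_pos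
  exact div_pos hK.β_pos (Real.rpow_pos_of_pos (by positivity) _)

theorem tendsto_step (K : SAConstants) (hK : K.Admissible) :
    Tendsto K.step atTop (𝓝 0) := by
  have h1 : Tendsto (fun n : ℕ => ((n : ℝ) + K.n₀) ^ (-(1 - K.𝔞))) atTop (𝓝 0) :=
    (tendsto_rpow_neg_atTop (by linarith [hK.𝔞_mem.2])).comp (tendsto_natCast_add_atTop K.n₀)
  have h2 := h1.const_mul K.β
  rw [mul_zero] at h2
  exact h2.congr fun n => (K.step_eq hK n).symm

/-- `max (𝔞 + κ₃) κ₂`: the drift of the controlled chain per step is of order `n ^ (driftExp - 1)`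
up to logarithms, the first exponent coming from the iterates and the second from the controls. -/
noncomputable def driftExp (K : SAConstants) : ℝ := max (K.𝔞 + K.κ₃) K.κ₂

/-- `n ^ (-r)` is a rate at which the distance to the fixed point is shown to decay, up to
`√(log (n ^ 2 / δ))`; it is positive and at least the rate asked for. From the time `n₁` on the
stepsizes are at most one and both contractions, that of the averaged noise by `1 - β_n` and that
of the iterates by `1 - β_n (1 - α)`, beat the decay of the errors they are compared with. -/
structure IsRate (K : SAConstants) (r ε : ℝ) (n₁ : ℕ) : Prop where
  pos : 0 < r
  target_le : 1 / 2 - 2 * K.κ₁ - K.driftExp ≤ r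
  le_noise : 2 * r ≤ 1 - K.𝔞 - 4 * K.κ₁
  lt_drift : r < 1 - 3 * K.κ₁ - K.driftExp
  ε_pos : 0 < ε
  ε_le_one : ε ≤ 1
  one_le : ∀ n : ℕ, n₁ ≤ n → 1 ≤ (n : ℝ) + K.n₀
  step_le_one : ∀ n : ℕ, n₁ ≤ n → K.step n ≤ 1
  iterate_contraction : ∀ n : ℕ, n₁ ≤ n →
    r / ((n : ℝ) + K.n₀) ≤ (1 - ε) * (K.step n * (K.c₃ / ((n : ℝ) + K.n₀) ^ K.κ₁))
  noise_contraction : ∀ n : ℕ, n₁ ≤ n →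
    2 * (r + K.κ₁) / ((n : ℝ) + K.n₀) ≤ (1 - ε) * K.step n

theorem exists_isRate (K : SAConstants) (hK : K.Admissible) :
    ∃ (r ε : ℝ) (n₁ : ℕ), K.IsRate r ε n₁ := by
  have hκ₁ := hK.κ₁_mem.1
  have hκ₂ := hK.κ₂_mem.1
  have hκ₃ := hK.κ₃_mem.1
  have h𝔞 := hK.𝔞_mem.1
  have hle := hK.κ₁_le
  have he₁ := hK.exponents₁
  have he₂ := hK.exponents₂
  have hβ := hK.β_pos
  have hc₃ := hK.c₃_pos
  have hn₀ := hK.n₀_pos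
  have hβc : 0 < K.β * K.c₃ := mul_pos hβ hc₃
  have hm₁ : K.𝔞 + K.κ₃ ≤ K.driftExp := le_max_left _ _
  have hm : 3 * K.κ₁ + K.driftExp < 1 := by
    have : K.driftExp < 1 - 3 * K.κ₁ := max_lt (by linarith) (by linarith)
    linarith
  -- The target exponent need not be positive; a small positive one keeps almost sure convergence.
  obtain ⟨r₀, hr₀, h1, h2, h3⟩ : ∃ r₀ : ℝ, 0 < r₀ ∧ 2 * r₀ ≤ 1 - K.𝔞 - 4 * K.κ₁ ∧
      r₀ < 1 - 3 * K.κ₁ - K.driftExp ∧ r₀ < K.β * K.c₃ := by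
    obtain ⟨q, hq, hq'⟩ := exists_between (show (0 : ℝ) <
      min ((1 - K.𝔞 - 4 * K.κ₁) / 2) (min (1 - 3 * K.κ₁ - K.driftExp) (K.β * K.c₃)) from
        lt_min (by linarith) (lt_min (by linarith) hβc))
    rw [lt_min_iff, lt_min_iff] at hq'
    exact ⟨q, hq, by linarith [hq'.1], hq'.2.1, hq'.2.2⟩
  set r := max (1 / 2 - 2 * K.κ₁ - K.driftExp) r₀ with hr
  have hr_pos : 0 < r := hr₀.trans_le (le_max_right _ _)
  have hr_noise : 2 * r ≤ 1 - K.𝔞 - 4 * K.κ₁ := by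
    have : r ≤ (1 - K.𝔞 - 4 * K.κ₁) / 2 := max_le (by linarith) (by linarith)
    linarith
  have hr_drift : r < 1 - 3 * K.κ₁ - K.driftExp := max_lt (by linarith) h2
  obtain ⟨ε₁, hε₁, hε₁', hev₁⟩ := exists_eventually_div_le (n₀ := K.n₀) (r := r)
    (g := K.β * K.c₃) (θ := 1 - K.𝔞 + K.κ₁) hr_pos.le hβc (by linarith) (fun h => by
      obtain ⟨-, h4, -⟩ := hK.of_𝔞_eq_κ₁ (by linarith)
      exact max_lt (by linarith) h3) hn₀
  obtain ⟨ε₂, hε₂, hε₂', hev₂⟩ := exists_eventually_div_le (n₀ := K.n₀) (r := 2 * (r + K.κ₁))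
    (g := K.β) (θ := 1 - K.𝔞) (by positivity) hβ (by linarith) (fun h => by
      have h5 := hK.of_𝔞_eq_zero (by linarith)
      linarith) hn₀
  obtain ⟨n₁, hn₁⟩ := eventually_atTop.1 (((tendsto_natCast_add_atTop K.n₀).eventually_ge_atTop
    1).and (((K.tendsto_step hK).eventually_le_const one_pos).and (hev₁.and hev₂)))
  have hstep := fun n => (K.step_pos hK n).le
  refine ⟨r, min ε₁ ε₂, n₁, hr_pos, le_max_left _ _, hr_noise, hr_drift, lt_min hε₁ hε₂,
    (min_le_left _ _).trans hε₁', fun n hn => (hn₁ n hn).1, fun n hn => (hn₁ n hn).2.1,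
    fun n hn => ?_, fun n hn => ?_⟩
  · have hw : 0 < (n : ℝ) + K.n₀ := by positivity
    have hmul : K.β * K.c₃ * ((n : ℝ) + K.n₀) ^ (-(1 - K.𝔞 + K.κ₁))
        = K.step n * (K.c₃ / ((n : ℝ) + K.n₀) ^ K.κ₁) := by
      rw [K.step_eq hK, neg_add, Real.rpow_add hw, Real.rpow_neg hw.le K.κ₁]
      ring
    have h := (hn₁ n hn).2.2.1
    rw [hmul] at h
    refine h.trans (mul_le_mul_of_nonneg_right (by linarith [min_le_left ε₁ ε₂]) ?_)
    exact mul_nonneg (hstep n) (div_nonneg hc₃.le (Real.rpow_nonneg hw.le _))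
  · have h := (hn₁ n hn).2.2.2
    rw [← K.step_eq hK] at h
    exact h.trans (mul_le_mul_of_nonneg_right (by linarith [min_le_right ε₁ ε₂]) (hstep n))

theorem abs_step_succ_sub_le (K : SAConstants) (hK : K.Admissible) (n : ℕ) :
    |(K.step (n + 1) - K.step n) / K.step n| ≤ ((n : ℝ) + K.n₀)⁻¹ := by
  have hn₀ := hK.n₀_pos
  have hw : 0 < (n : ℝ) + K.n₀ := by positivity
  have h𝔞 := hK.𝔞_mem
  have hs := K.step_pos hK n
  have hlow := one_sub_div_mul_rpow_neg_le hw (show 0 ≤ 1 - K.𝔞 by linarith [h𝔞.2])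
  have hup : ((n : ℝ) + K.n₀ + 1) ^ (-(1 - K.𝔞)) ≤ ((n : ℝ) + K.n₀) ^ (-(1 - K.𝔞)) :=
    Real.rpow_le_rpow_of_nonpos hw (by linarith) (by linarith [h𝔞.2])
  have hsucc : K.step (n + 1) = K.β * ((n : ℝ) + K.n₀ + 1) ^ (-(1 - K.𝔞)) := by
    rw [K.step_eq hK]
    push_cast
    ring_nf
  have hn := K.step_eq hK n
  rw [abs_div, abs_of_pos hs, div_le_iff₀ hs, abs_of_nonpos, hsucc, hn]
  · have h1 := mul_le_mul_of_nonneg_left hlow hK.β_pos.le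
    have h2 : (1 - K.𝔞) / ((n : ℝ) + K.n₀) ≤ ((n : ℝ) + K.n₀)⁻¹ := by
      rw [inv_eq_one_div]
      exact div_le_div_of_nonneg_right (by linarith [h𝔞.1]) hw.le
    have h3 := mul_le_mul_of_nonneg_right h2 hs.le
    rw [hn] at h3
    linarith
  · rw [hsucc, hn]
    linarith [mul_le_mul_of_nonneg_left hup hK.β_pos.le]

end SAConstants

theorem add_one_rpow_le_two_mul {w κ : ℝ} (hw : 1 ≤ w) (hκ₀ : 0 ≤ κ) (hκ₁ : κ ≤ 1) :
    (w + 1) ^ κ ≤ 2 * w ^ κ := by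
  have hw₀ : 0 ≤ w := by linarith
  calc (w + 1) ^ κ ≤ (2 * w) ^ κ := Real.rpow_le_rpow (by linarith) (by linarith) hκ₀
    _ = 2 ^ κ * w ^ κ := Real.mul_rpow (by norm_num) hw₀
    _ ≤ 2 * w ^ κ := by
        refine mul_le_mul_of_nonneg_right ?_ (Real.rpow_nonneg hw₀ _)
        exact (Real.rpow_le_rpow_of_exponent_le (by norm_num) hκ₁).trans_eq (Real.rpow_one 2)

/-! ### The averaged noise and the pathwise error bound -/

namespace SAConstants.IsRate

variable {K : SAConstants} {r ε : ℝ} {n₁ : ℕ}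

/-- Averaging martingale differences of size `b n ^ κ₁` with the stepsizes, from the time `n₁` on,
gives variance of order `n ^ (-2 (r + κ₁))`. -/
theorem linearRecVar_le (h : K.IsRate r ε n₁) (hK : K.Admissible) {b : ℝ}
    {b' : ℕ → ℝ} (hb' : ∀ n, 0 ≤ b' n) (hbb : ∀ n, n₁ ≤ n → b' n ≤ b * ((n : ℝ) + K.n₀) ^ K.κ₁)
    {n : ℕ} (hn : n₁ ≤ n) :
    linearRecVar (fun n => 1 - K.step n) (fun n => if n < n₁ then 0 else K.step n) b' n
      ≤ (K.β * b ^ 2 / ε + 1) * ((n : ℝ) + K.n₀) ^ (-(2 * (r + K.κ₁))) := by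
  have hε := h.ε_pos
  have hβ := hK.β_pos
  have hn₀ := hK.n₀_pos
  have hκ := hK.κ₁_mem.1
  have hr := h.pos
  have hzero : ∀ n, n ≤ n₁ → linearRecVar (fun n => 1 - K.step n)
      (fun n => if n < n₁ then 0 else K.step n) b' n = 0 := by
    intro n hn
    induction n with
    | zero => rfl
    | succ n ih => simp [linearRecVar, ih (by omega), show n < n₁ by omega]
  refine le_mul_rpow_neg_of_recursion (R := K.β * b ^ 2) (γ := K.step) (ε := ε) hn₀
    (by positivity) (by positivity) ?_ h.step_le_one (fun n _ => (K.step_pos hK n).le)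
    h.noise_contraction ?_ ?_ n hn le_rfl
  · rw [mul_add, mul_one, mul_div_cancel₀ _ hε.ne']
    linarith
  · rw [hzero n₁ le_rfl]
    positivity
  · intro n hn _
    have hs := K.step_pos hK n
    have hs1 := h.step_le_one n hn
    have hw1 := h.one_le n hn
    have hw : 0 < (n : ℝ) + K.n₀ := by linarith
    simp only [linearRecVar, if_neg (show ¬ n < n₁ by omega)]
    have hv := linearRecVar_nonneg (fun n => 1 - K.step n)
      (fun n => if n < n₁ then 0 else K.step n) b' n
    set v := linearRecVar (fun n => 1 - K.step n)
      (fun n => if n < n₁ then 0 else K.step n) b' n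
    have h1 : (1 - K.step n) ^ 2 * v ≤ (1 - K.step n) * v :=
      mul_le_mul_of_nonneg_right (by nlinarith) hv
    have h2 : b' n ^ 2 ≤ b ^ 2 * ((n : ℝ) + K.n₀) ^ (2 * K.κ₁) := by
      calc b' n ^ 2 ≤ (b * ((n : ℝ) + K.n₀) ^ K.κ₁) ^ 2 := pow_le_pow_left₀ (hb' n) (hbb n hn) 2
        _ = b ^ 2 * ((n : ℝ) + K.n₀) ^ (2 * K.κ₁) := by
            rw [mul_pow, ← Real.rpow_mul_natCast hw.le]
            congr 2
            push_cast
            ring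
    have h3 : K.step n * b' n ^ 2 ≤ K.β * b ^ 2 * ((n : ℝ) + K.n₀) ^ (-(2 * (r + K.κ₁))) := by
      calc K.step n * b' n ^ 2
          ≤ K.step n * (b ^ 2 * ((n : ℝ) + K.n₀) ^ (2 * K.κ₁)) :=
            mul_le_mul_of_nonneg_left h2 hs.le
        _ = K.β * b ^ 2 * ((n : ℝ) + K.n₀) ^ (-(1 - K.𝔞) + 2 * K.κ₁) := by
            rw [K.step_eq hK, Real.rpow_add hw]
            ring
        _ ≤ _ := by
            refine mul_le_mul_of_nonneg_left (Real.rpow_le_rpow_of_exponent_le hw1 ?_)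
              (by positivity)
            linarith [h.le_noise]
    have h4 := mul_le_mul_of_nonneg_left h3 hs.le
    have h5 : (K.step n * b' n) ^ 2 = K.step n * (K.step n * b' n ^ 2) := by ring
    rw [h5]
    exact add_le_add h1 h4

/-- Pathwise bound for a contractive recursion whose noise is the sum of `ξ`, a telescoping part
`W n - W (n + 1)` and a small part `e`, when the average `A` of `ξ` is small. The shifted iterate
`x n - A n + β_n W n` satisfies a recursion that is driven by small terms only. -/
theorem dist_le (h : K.IsRate r ε n₁) (hK : K.Admissible) {d : ℕ} {N : Seminorm ℝ (Fin d → ℝ)}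
    {CN : ℝ} (hCN : 0 < CN) (hN : ∀ v, N v ≤ CN * ‖v‖) {T : ℕ} {α : ℕ → ℝ}
    {x f ξ W e A : ℕ → Fin d → ℝ} {xs : Fin d → ℝ} {b D G : ℝ} (hb : 0 ≤ b)
    (hx : ∀ n, n₁ ≤ n →
      x (n + 1) = x n + K.step n • (f n - x n + (ξ n + W n - W (n + 1) + e n)))
    (hA₁ : A n₁ = 0) (hA : ∀ n, n₁ ≤ n → A (n + 1) = (1 - K.step n) • A n + K.step n • ξ n)
    (hf : ∀ n, n₁ ≤ n → N (f n - xs) ≤ α n * N (x n - xs))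
    (hα₀ : ∀ n, 0 ≤ α n) (hα : ∀ n, n₁ ≤ n → K.c₃ / ((n : ℝ) + K.n₀) ^ K.κ₁ ≤ 1 - α n)
    (hW : ∀ n, n₁ ≤ n → ‖W n‖ ≤ b * ((n : ℝ) + K.n₀) ^ K.κ₁)
    (he : ∀ n, n₁ ≤ n → ‖e n‖ ≤ b * ((n : ℝ) + K.n₀) ^ (-(r + K.κ₁)))
    (hAG : ∀ n, n₁ ≤ n → n ≤ T → ‖A n‖ ≤ G * ((n : ℝ) + K.n₀) ^ (-(r + K.κ₁)))
    (hD : N (x n₁ - xs) ≤ D) {n : ℕ} (hn : n₁ ≤ n) (hnT : n ≤ T) :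
    N (x n - xs) ≤ 2 * (CN * (G + (2 * K.β + 3) * b) / K.c₃ / ε +
      (D + CN * K.β * b) * ((n₁ : ℝ) + K.n₀)) * ((n : ℝ) + K.n₀) ^ (-r) := by
  have hε := h.ε_pos
  have hβ := hK.β_pos
  have hn₀ := hK.n₀_pos
  have hκ := hK.κ₁_mem.1
  have hκ' := hK.κ₁_mem.2
  have hr := h.pos
  have hc₃ := hK.c₃_pos
  have h𝔞 := hK.𝔞_mem
  have hrn := h.le_noise
  have hD₀ : 0 ≤ D := (apply_nonneg N _).trans hD
  have hG : 0 ≤ G := by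
    have h1 := (norm_nonneg _).trans (hAG n hn hnT)
    have hw : 0 < (n : ℝ) + K.n₀ := by positivity
    exact nonneg_of_mul_nonneg_left h1 (Real.rpow_pos_of_pos hw _)
  set R := CN * (G + (2 * K.β + 3) * b) / K.c₃ with hR
  have hR₀ : 0 ≤ R := by positivity
  set B := R / ε + (D + CN * K.β * b) * ((n₁ : ℝ) + K.n₀) with hB
  have hinit : 0 ≤ (D + CN * K.β * b) * ((n₁ : ℝ) + K.n₀) := by positivity
  have hB₀ : 0 ≤ B := by positivity
  have hRB : R ≤ ε * B := by
    rw [hB, mul_add, mul_div_cancel₀ _ hε.ne']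
    linarith [mul_nonneg hε.le hinit]
  have hβW : ∀ n, n₁ ≤ n →
      K.step n * N (W n) ≤ CN * (K.β * b) * ((n : ℝ) + K.n₀) ^ (-(r + K.κ₁)) := by
    intro n hn
    have hw1 := h.one_le n hn
    have hw : 0 < (n : ℝ) + K.n₀ := by linarith
    calc K.step n * N (W n) ≤ K.step n * (CN * (b * ((n : ℝ) + K.n₀) ^ K.κ₁)) := by
          refine mul_le_mul_of_nonneg_left ((hN _).trans ?_) (K.step_pos hK n).le
          exact mul_le_mul_of_nonneg_left (hW n hn) hCN.le
      _ = CN * (K.β * b) * ((n : ℝ) + K.n₀) ^ (-(1 - K.𝔞) + K.κ₁) := by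
          rw [K.step_eq hK, Real.rpow_add hw]
          ring
      _ ≤ _ := by
          refine mul_le_mul_of_nonneg_left (Real.rpow_le_rpow_of_exponent_le hw1 ?_)
            (by positivity)
          linarith
  set g : ℕ → Fin d → ℝ := fun n => K.step n • W n +
    ((K.step (n + 1) - K.step n) / K.step n) • W (n + 1) + e n with hg
  have hsmall : ∀ n, n₁ ≤ n → n ≤ T →
      N (A n) + K.step n * N (W n) + N (g n) ≤ (1 - α n) * (R * ((n : ℝ) + K.n₀) ^ (-r)) := by
    intro n hn hnT
    have hw1 := h.one_le n hn
    have hw : 0 < (n : ℝ) + K.n₀ := by linarith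
    set w := (n : ℝ) + K.n₀ with hwdef
    have hq : 0 ≤ w ^ (-(r + K.κ₁)) := Real.rpow_nonneg hw.le _
    have h1 : N (A n) ≤ CN * G * w ^ (-(r + K.κ₁)) := by
      have := mul_le_mul_of_nonneg_left (hAG n hn hnT) hCN.le
      exact (hN _).trans (this.trans_eq (by ring))
    have h2 := hβW n hn
    have h3 : N (e n) ≤ CN * b * w ^ (-(r + K.κ₁)) := by
      have := mul_le_mul_of_nonneg_left (he n hn) hCN.le
      exact (hN _).trans (this.trans_eq (by ring))
    have h4 : N (((K.step (n + 1) - K.step n) / K.step n) • W (n + 1))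
        ≤ CN * (2 * b) * w ^ (-(r + K.κ₁)) := by
      rw [map_smul_eq_mul, Real.norm_eq_abs]
      have hW' : N (W (n + 1)) ≤ CN * (b * (2 * w ^ K.κ₁)) := by
        refine (hN _).trans (mul_le_mul_of_nonneg_left ((hW (n + 1) (by omega)).trans ?_) hCN.le)
        refine mul_le_mul_of_nonneg_left ?_ hb
        have : ((n + 1 : ℕ) : ℝ) + K.n₀ = w + 1 := by rw [hwdef]; push_cast; ring
        rw [this]
        exact add_one_rpow_le_two_mul hw1 hκ hκ'
      calc _ ≤ w⁻¹ * (CN * (b * (2 * w ^ K.κ₁))) :=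
            mul_le_mul (K.abs_step_succ_sub_le hK n) hW' (apply_nonneg N _) (by positivity)
        _ = CN * (2 * b) * w ^ (-1 + K.κ₁) := by
            rw [Real.rpow_add hw, Real.rpow_neg_one]
            ring
        _ ≤ _ := by
            refine mul_le_mul_of_nonneg_left (Real.rpow_le_rpow_of_exponent_le hw1 ?_)
              (by positivity)
            linarith [h𝔞.1]
    have h5 : N (g n) ≤ K.step n * N (W n)
        + N (((K.step (n + 1) - K.step n) / K.step n) • W (n + 1)) + N (e n) := by
      refine (map_add_le_add N _ _).trans (add_le_add_left ?_ _)
      refine (map_add_le_add N _ _).trans (add_le_add_left ?_ _)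
      rw [map_smul_eq_mul, Real.norm_eq_abs, abs_of_pos (K.step_pos hK n)]
    have h6 : K.c₃ / w ^ K.κ₁ * (R * w ^ (-r))
        = CN * (G + (2 * K.β + 3) * b) * w ^ (-(r + K.κ₁)) := by
      rw [neg_add, Real.rpow_add hw, Real.rpow_neg hw.le K.κ₁, hR]
      field_simp
    have h7 := mul_le_mul_of_nonneg_right (hα n hn)
      (mul_nonneg hR₀ (Real.rpow_nonneg hw.le (-r)))
    rw [h6] at h7
    linarith
  have hγ₀ : ∀ n, n₁ ≤ n → 0 ≤ 1 - α n := fun n hn => by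
    have hw : 0 < (n : ℝ) + K.n₀ := by positivity
    exact (div_nonneg hc₃.le (Real.rpow_nonneg hw.le _)).trans (hα n hn)
  have hz := le_mul_rpow_neg_of_recursion (n₀ := K.n₀) (r := r) (R := R) (B := B) (ε := ε)
    (n₁ := n₁) (T := T) (u := fun n => N (x n - A n + K.step n • W n - xs))
    (γ := fun n => K.step n * (1 - α n)) hn₀ hr.le hB₀ hRB
    (fun n hn => mul_le_one₀ (h.step_le_one n hn) (hγ₀ n hn) (by linarith [hα₀ n]))
    (fun n hn => mul_nonneg (K.step_pos hK n).le (hγ₀ n hn))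
    (fun n hn => (h.iterate_contraction n hn).trans
      (mul_le_mul_of_nonneg_left (mul_le_mul_of_nonneg_left (hα n hn) (K.step_pos hK n).le)
        (by linarith [h.ε_le_one]))) ?_ ?_ n hn hnT
  · have hw1 := h.one_le n hn
    have hw : 0 < (n : ℝ) + K.n₀ := by linarith
    have hsplit : N (x n - xs) ≤ N (x n - A n + K.step n • W n - xs) + N (A n)
        + K.step n * N (W n) := by
      have heq : x n - xs = (x n - A n + K.step n • W n - xs) + A n - K.step n • W n := by abel
      have h1 := map_sub_le_add N ((x n - A n + K.step n • W n - xs) + A n) (K.step n • W n)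
      have h2 := map_add_le_add N (x n - A n + K.step n • W n - xs) (A n)
      rw [← heq, map_smul_eq_mul, Real.norm_eq_abs, abs_of_pos (K.step_pos hK n)] at h1
      linarith
    have hwr : 0 ≤ ((n : ℝ) + K.n₀) ^ (-r) := Real.rpow_nonneg hw.le _
    have h1 : (1 - α n) * (R * ((n : ℝ) + K.n₀) ^ (-r)) ≤ R * ((n : ℝ) + K.n₀) ^ (-r) :=
      mul_le_of_le_one_left (mul_nonneg hR₀ hwr) (by linarith [hα₀ n])
    have h2 : R * ((n : ℝ) + K.n₀) ^ (-r) ≤ B * ((n : ℝ) + K.n₀) ^ (-r) :=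
      mul_le_mul_of_nonneg_right
        (hRB.trans (mul_le_of_le_one_left hB₀ h.ε_le_one)) hwr
    have h3 := hsmall n hn hnT
    have h4 := apply_nonneg N (g n)
    linarith
  · have hw1 := h.one_le n₁ le_rfl
    have hw : 0 < (n₁ : ℝ) + K.n₀ := by linarith
    have h1 : N (x n₁ - A n₁ + K.step n₁ • W n₁ - xs) ≤ D + CN * K.β * b := by
      have heq : x n₁ - A n₁ + K.step n₁ • W n₁ - xs = (x n₁ - xs) + K.step n₁ • W n₁ := by
        rw [hA₁]
        abel
      have h2 := map_add_le_add N (x n₁ - xs) (K.step n₁ • W n₁)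
      rw [map_smul_eq_mul, Real.norm_eq_abs, abs_of_pos (K.step_pos hK n₁)] at h2
      rw [heq]
      have h3 : ((n₁ : ℝ) + K.n₀) ^ (-(r + K.κ₁)) ≤ 1 :=
        Real.rpow_le_one_of_one_le_of_nonpos hw1 (by linarith)
      have h4 := mul_le_mul_of_nonneg_left h3 (show 0 ≤ CN * (K.β * b) by positivity)
      linarith [hβW n₁ le_rfl]
    refine h1.trans ?_
    have h5 : (1 : ℝ) ≤ ((n₁ : ℝ) + K.n₀) * ((n₁ : ℝ) + K.n₀) ^ (-r) := by
      rw [← Real.rpow_one_add' hw.le (by linarith [h𝔞.1])]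
      exact Real.one_le_rpow hw1 (by linarith [h𝔞.1])
    have h6 := mul_le_mul_of_nonneg_left h5 (show 0 ≤ D + CN * K.β * b by positivity)
    have h7 := mul_nonneg (div_nonneg hR₀ hε.le) (Real.rpow_nonneg hw.le (-r))
    rw [hB, add_mul]
    linarith
  · intro n hn hnT
    have hs := K.step_pos hK n
    have hs1 := h.step_le_one n hn
    have heq : x (n + 1) - A (n + 1) + K.step (n + 1) • W (n + 1) - xs
        = (1 - K.step n) • (x n - A n + K.step n • W n - xs)
          + K.step n • ((f n - xs) + g n) := by
      rw [hx n hn, hA n hn]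
      funext l
      simp only [hg, Pi.add_apply, Pi.sub_apply, Pi.smul_apply, smul_eq_mul]
      field_simp
      ring
    have h1 : N (x n - xs) ≤ N (x n - A n + K.step n • W n - xs) + N (A n)
        + K.step n * N (W n) := by
      have heq : x n - xs = (x n - A n + K.step n • W n - xs) + A n - K.step n • W n := by abel
      have h1 := map_sub_le_add N ((x n - A n + K.step n • W n - xs) + A n) (K.step n • W n)
      have h2 := map_add_le_add N (x n - A n + K.step n • W n - xs) (A n)
      rw [← heq, map_smul_eq_mul, Real.norm_eq_abs, abs_of_pos hs] at h1
      linarith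
    have h2 : N (x (n + 1) - A (n + 1) + K.step (n + 1) • W (n + 1) - xs)
        ≤ (1 - K.step n) * N (x n - A n + K.step n • W n - xs)
          + K.step n * (N (f n - xs) + N (g n)) := by
      rw [heq]
      refine (map_add_le_add N _ _).trans ?_
      rw [map_smul_eq_mul, map_smul_eq_mul, Real.norm_eq_abs, Real.norm_eq_abs, abs_of_pos hs,
        abs_of_nonneg (by linarith)]
      linarith [mul_le_mul_of_nonneg_left (map_add_le_add N (f n - xs) (g n)) hs.le]
    set Z := N (x n - A n + K.step n • W n - xs)
    have hα1 : α n ≤ 1 := by linarith [hγ₀ n hn]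
    have h3 := mul_le_mul_of_nonneg_left h1 (hα₀ n)
    have h4 : α n * (N (A n) + K.step n * N (W n)) ≤ N (A n) + K.step n * N (W n) :=
      mul_le_of_le_one_left
        (add_nonneg (apply_nonneg N _) (mul_nonneg hs.le (apply_nonneg N _))) hα1
    have h5 : N (f n - xs) + N (g n)
        ≤ α n * Z + (1 - α n) * (R * ((n : ℝ) + K.n₀) ^ (-r)) := by
      linarith [hf n hn, hsmall n hn hnT.le]
    have h6 := mul_le_mul_of_nonneg_left h5 hs.le
    refine h2.trans ?_
    linarith

end SAConstants.IsRate

/-! ### Poisson solutions along the scheme -/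

namespace SAModel

variable {d d₁ : ℕ} {Y : Type*} [Fintype Y] [DecidableEq Y]

/-- Coordinate `l` of the solution of the Poisson equation of the chain `p^{(ζ, x)}` with
right-hand side `F(x, ·)`, vanishing at the designated state. -/
noncomputable def poisson (S : SAModel d d₁ Y) (ζ : Fin d₁ → ℝ) (x : Fin d → ℝ) (l : Fin d) :
    Y → ℝ :=
  poissonSol (S.p ζ x) S.iStar fun i => S.F x i l

namespace Assumptions

variable {S : SAModel d d₁ Y} {N : Seminorm ℝ (Fin d → ℝ)} {K : SAConstants}

/-- The contraction rate controls `μ_min`, hence the hitting times. -/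
theorem expectedHittingTime_le (hS : S.Assumptions N K) (hK : K.Admissible) {w : ℝ} (hw : 0 < w)
    {ζ : Fin d₁ → ℝ} (hζ : ζ ∈ S.Z) (hα : K.c₃ / w ^ K.κ₁ ≤ 1 - S.α ζ) {x : Fin d → ℝ}
    (hx : x ∈ S.X) (i : Y) :
    expectedHittingTime (S.p ζ x) S.iStar i ≤
      ENNReal.ofReal (K.c₁ * K.c₂ / K.c₃ * w ^ K.κ₁) := by
  refine (hS.hitting ζ hζ x hx i).trans (ENNReal.ofReal_le_ofReal ?_)
  have hμ := hS.μMin_pos ζ hζ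
  have hwκ : 0 < w ^ K.κ₁ := Real.rpow_pos_of_pos hw _
  rw [hS.one_sub_α ζ hζ, div_le_iff₀ hwκ] at hα
  rw [div_le_iff₀ hμ, div_mul_eq_mul_div, div_mul_eq_mul_div, le_div_iff₀ hK.c₃_pos]
  have := mul_le_mul_of_nonneg_left hα hK.c₁_pos.le
  linarith

theorem abs_F_le (hS : S.Assumptions N K) {CN : ℝ} (hCN : 0 < CN) (hN : ∀ v, ‖v‖ ≤ CN * N v)
    {x : Fin d → ℝ} (hx : x ∈ S.X) (l : Fin d) (i : Y) : |S.F x i l| ≤ CN * |K.c₉| := by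
  calc |S.F x i l| ≤ ‖S.F x i‖ := norm_le_pi_norm (S.F x i) l
    _ ≤ CN * N (S.F x i) := hN _
    _ ≤ CN * |K.c₉| :=
      mul_le_mul_of_nonneg_left ((hS.F_bound x hx i).trans (le_abs_self _)) hCN.le

theorem continuousOn_F (hS : S.Assumptions N K) (i : Y) (l : Fin d) :
    ContinuousOn (fun x => S.F x i l) S.X := by
  obtain ⟨C, hC, hNC⟩ := N.exists_le_mul_norm
  refine LipschitzOnWith.continuousOn (K := (|K.c₆| * C).toNNReal)
    (LipschitzOnWith.of_dist_le_mul fun x hx x' hx' => ?_)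
  rw [Real.coe_toNNReal _ (by positivity), Real.dist_eq, dist_eq_norm, mul_assoc]
  calc |S.F x i l - S.F x' i l| ≤ K.c₆ * N (x - x') := hS.F_lipschitz x hx x' hx' i l
    _ ≤ |K.c₆| * N (x - x') := mul_le_mul_of_nonneg_right (le_abs_self _) (apply_nonneg N _)
    _ ≤ |K.c₆| * (C * ‖x - x'‖) := mul_le_mul_of_nonneg_left (hNC _) (abs_nonneg _)

theorem poisson_sub_sum (hS : S.Assumptions N K) (hK : K.Admissible) {ζ : Fin d₁ → ℝ}
    (hζ : ζ ∈ S.Z) {x : Fin d → ℝ} (hx : x ∈ S.X) (l : Fin d) (i : Y) :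
    S.poisson ζ x l i - ∑ j, S.p ζ x i j * S.poisson ζ x l j = S.F x i l - S.FBar ζ x x l := by
  have h := poissonSol_sub_sum (hS.p_stochastic ζ hζ x hx) (hS.μ_stationary ζ hζ x hx)
    (div_nonneg hK.c₁_pos.le (hS.μMin_pos ζ hζ).le) (hS.hitting ζ hζ x hx)
    (fun i => S.F x i l) i
  refine h.trans ?_
  simp [FBar, Finset.sum_apply]

theorem abs_poisson_le (hS : S.Assumptions N K) (hK : K.Admissible) {CN : ℝ} (hCN : 0 < CN)
    (hN : ∀ v, ‖v‖ ≤ CN * N v) {w : ℝ} (hw : 0 < w) {ζ : Fin d₁ → ℝ} (hζ : ζ ∈ S.Z)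
    (hα : K.c₃ / w ^ K.κ₁ ≤ 1 - S.α ζ) {x : Fin d → ℝ} (hx : x ∈ S.X) (l : Fin d) (i : Y) :
    |S.poisson ζ x l i| ≤ 2 * (CN * |K.c₉|) * (K.c₁ * K.c₂ / K.c₃ * w ^ K.κ₁) := by
  have := hK.c₁_pos
  have := hK.c₂_pos
  have := hK.c₃_pos
  exact abs_poissonSol_le (hS.p_stochastic ζ hζ x hx) (hS.μ_stationary ζ hζ x hx) (by positivity)
    (hS.expectedHittingTime_le hK hw hζ hα hx) (hS.abs_F_le hCN hN hx l) i

theorem abs_poisson_sub_le (hS : S.Assumptions N K) (hK : K.Admissible) {CN : ℝ} (hCN : 0 < CN)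
    (hN : ∀ v, ‖v‖ ≤ CN * N v) {w w' : ℝ} (hw : 0 < w) (hw' : 0 < w') {ζ ζ' : Fin d₁ → ℝ}
    (hζ : ζ ∈ S.Z) (hζ' : ζ' ∈ S.Z) (hα : K.c₃ / w ^ K.κ₁ ≤ 1 - S.α ζ)
    (hα' : K.c₃ / w' ^ K.κ₁ ≤ 1 - S.α ζ') {x x' : Fin d → ℝ} (hx : x ∈ S.X) (hx' : x' ∈ S.X)
    {Δ E : ℝ} (hΔ : N (x' - x) ≤ Δ) (hE : ∀ i, ∑ j, |S.p ζ' x' i j - S.p ζ x i j| ≤ E)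
    (l : Fin d) (i : Y) :
    |S.poisson ζ' x' l i - S.poisson ζ x l i| ≤
      (2 * (|K.c₆| * Δ) + 2 * (E * (2 * (CN * |K.c₉|) * (K.c₁ * K.c₂ / K.c₃ * w ^ K.κ₁)))) *
        (K.c₁ * K.c₂ / K.c₃ * w' ^ K.κ₁) := by
  have := hK.c₁_pos
  have := hK.c₂_pos
  have := hK.c₃_pos
  refine abs_poissonSol_sub_le (hS.p_stochastic ζ' hζ' x' hx') (hS.p_stochastic ζ hζ x hx)
    (hS.μ_stationary ζ' hζ' x' hx') (hS.μ_stationary ζ hζ x hx) (by positivity) (by positivity)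
    (hS.expectedHittingTime_le hK hw' hζ' hα' hx') (hS.expectedHittingTime_le hK hw hζ hα hx)
    (hS.abs_F_le hCN hN hx l) (fun j => ?_) hE i
  calc |S.F x' j l - S.F x j l| ≤ K.c₆ * N (x' - x) := hS.F_lipschitz x' hx' x hx j l
    _ ≤ |K.c₆| * N (x' - x) := mul_le_mul_of_nonneg_right (le_abs_self _) (apply_nonneg N _)
    _ ≤ |K.c₆| * Δ := mul_le_mul_of_nonneg_left hΔ (abs_nonneg _)

end Assumptions

end SAModel

/-! ### The martingale noise of a run -/

theorem measurable_apply_of_measurableSet {Ω Y : Type*} [Fintype Y] {m : MeasurableSpace Ω}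
    {y : Ω → Y} (hy : ∀ i, MeasurableSet {ω | y ω = i}) {g : Ω → Y → ℝ}
    (hg : ∀ i, Measurable fun ω => g ω i) : Measurable fun ω => g ω (y ω) := by
  classical
  have : (fun ω => g ω (y ω)) = fun ω => ∑ i, {ω | y ω = i}.indicator (fun ω => g ω i) ω := by
    funext ω
    simp [Set.indicator_apply]
  rw [this]
  exact Finset.measurable_sum _ fun i _ => (hg i).indicator (hy i)

namespace SAModel

variable {d d₁ : ℕ} {Y : Type*} [Fintype Y]

/-- The martingale difference `M_{n+1} + V_n(y_{n+1}) - (p_n V_n)(y_n)`, with `V_n` the Poisson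
solution at time `n`. -/
noncomputable def noise [DecidableEq Y] (S : SAModel d d₁ Y) {Ω : Type*} (ζ : ℕ → Ω → (Fin d₁ → ℝ))
    (x : ℕ → Ω → (Fin d → ℝ)) (y : ℕ → Ω → Y) (M : ℕ → Ω → (Fin d → ℝ)) (l : Fin d) (n : ℕ)
    (ω : Ω) : ℝ :=
  M (n + 1) ω l + (S.poisson (ζ n ω) (x n ω) l (y (n + 1) ω) -
    ∑ j, S.p (ζ n ω) (x n ω) (y n ω) j * S.poisson (ζ n ω) (x n ω) l j)

namespace IsRun

variable {S : SAModel d d₁ Y} {N : Seminorm ℝ (Fin d → ℝ)} {K : SAConstants} {Ω : Type*}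
  [mΩ : MeasurableSpace Ω] {P : Measure Ω} {ℱ : Filtration ℕ mΩ} {ζ : ℕ → Ω → (Fin d₁ → ℝ)}
  {x : ℕ → Ω → (Fin d → ℝ)} {y : ℕ → Ω → Y} {M : ℕ → Ω → (Fin d → ℝ)}

theorem measurable_transition (hR : S.IsRun K P ℱ ζ x y M) (n : ℕ) (j : Y) :
    Measurable[ℱ n] fun ω => S.p (ζ n ω) (x n ω) (y n ω) j :=
  @measurable_apply_of_measurableSet Ω Y _ (ℱ n) (y n) (hR.y_adapted n)
    (fun ω i => S.p (ζ n ω) (x n ω) i j) fun i => hR.p_adapted n i j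

variable [DecidableEq Y]

theorem measurable_poisson (hR : S.IsRun K P ℱ ζ x y M) (hS : S.Assumptions N K) (n : ℕ)
    (l : Fin d) (i : Y) : Measurable[ℱ n] fun ω => S.poisson (ζ n ω) (x n ω) l i := by
  refine @measurable_poissonSol Y _ _ Ω (ℱ n) (fun ω => S.p (ζ n ω) (x n ω)) S.iStar
    (fun ω j => S.F (x n ω) j l) (hR.p_adapted n) (fun j => ?_) i
  exact (continuousOn_iff_continuous_domRestrict.1 (hS.continuousOn_F j l)).measurable.comp
    (@Measurable.subtype_mk _ _ (ℱ n) _ _ _ (hR.x_adapted n) (hR.x_mem n))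

theorem measurable_noise (hR : S.IsRun K P ℱ ζ x y M) (hS : S.Assumptions N K) (n : ℕ)
    (l : Fin d) : Measurable[ℱ (n + 1)] (S.noise ζ x y M l n) := by
  have hle := ℱ.mono n.le_succ
  have h1 : Measurable[ℱ (n + 1)] fun ω => M (n + 1) ω l :=
    (measurable_pi_apply l).comp (hR.M_adapted (n + 1))
  have h2 : Measurable[ℱ (n + 1)] fun ω => S.poisson (ζ n ω) (x n ω) l (y (n + 1) ω) :=
    @measurable_apply_of_measurableSet Ω Y _ (ℱ (n + 1)) (y (n + 1)) (hR.y_adapted (n + 1))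
      (fun ω i => S.poisson (ζ n ω) (x n ω) l i)
      fun i => (hR.measurable_poisson hS n l i).mono hle le_rfl
  have h3 : Measurable[ℱ (n + 1)]
      fun ω => ∑ j, S.p (ζ n ω) (x n ω) (y n ω) j * S.poisson (ζ n ω) (x n ω) l j := by
    refine Measurable.mono ?_ hle le_rfl
    exact @Finset.measurable_sum _ _ _ _ _ _ (ℱ n) _ _ fun j _ =>
      (hR.measurable_transition n j).mul (hR.measurable_poisson hS n l j)
  exact h1.add (h2.sub h3)

theorem ae_abs_poisson_le (hR : S.IsRun K P ℱ ζ x y M) (hS : S.Assumptions N K)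
    (hK : K.Admissible) {CN : ℝ} (hCN : 0 < CN) (hN : ∀ v, ‖v‖ ≤ CN * N v) (n : ℕ) :
    ∀ᵐ ω ∂P, ∀ l i, |S.poisson (ζ n ω) (x n ω) l i| ≤
      2 * (CN * |K.c₉|) * (K.c₁ * K.c₂ / K.c₃ * ((n : ℝ) + K.n₀) ^ K.κ₁) := by
  have hn₀ := hK.n₀_pos
  filter_upwards [hR.contraction_rate n] with ω hω l i
  exact hS.abs_poisson_le hK hCN hN (by positivity) (hR.ζ_mem n ω) hω (hR.x_mem n ω) l i

theorem ae_abs_noise_le (hR : S.IsRun K P ℱ ζ x y M) (hS : S.Assumptions N K)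
    (hK : K.Admissible) {CN : ℝ} (hCN : 0 < CN) (hN : ∀ v, ‖v‖ ≤ CN * N v) (n : ℕ) (l : Fin d) :
    ∀ᵐ ω ∂P, |S.noise ζ x y M l n ω| ≤
      |K.c₇| + 4 * (CN * |K.c₉|) * (K.c₁ * K.c₂ / K.c₃ * ((n : ℝ) + K.n₀) ^ K.κ₁) := by
  filter_upwards [hR.ae_abs_poisson_le hS hK hCN hN n, hR.M_bound n] with ω hV hM
  have hp := hS.p_stochastic _ (hR.ζ_mem n ω) _ (hR.x_mem n ω)
  set c := 2 * (CN * |K.c₉|) * (K.c₁ * K.c₂ / K.c₃ * ((n : ℝ) + K.n₀) ^ K.κ₁)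
  have h1 : |∑ j, S.p (ζ n ω) (x n ω) (y n ω) j * S.poisson (ζ n ω) (x n ω) l j| ≤ c := by
    calc _ ≤ ∑ j, |S.p (ζ n ω) (x n ω) (y n ω) j * S.poisson (ζ n ω) (x n ω) l j| :=
          Finset.abs_sum_le_sum_abs _ _
      _ ≤ ∑ j, S.p (ζ n ω) (x n ω) (y n ω) j * c := Finset.sum_le_sum fun j _ => by
          rw [abs_mul, abs_of_nonneg (Matrix.nonneg_of_mem_rowStochastic hp)]
          exact mul_le_mul_of_nonneg_left (hV l j) (Matrix.nonneg_of_mem_rowStochastic hp)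
      _ = c := by rw [← Finset.sum_mul, Matrix.sum_row_of_mem_rowStochastic hp, one_mul]
  have h2 : |M (n + 1) ω l| ≤ |K.c₇| := (hM l).trans (le_abs_self _)
  have h3 := hV l (y (n + 1) ω)
  have h4 := abs_add_le (M (n + 1) ω l) (S.poisson (ζ n ω) (x n ω) l (y (n + 1) ω) -
    ∑ j, S.p (ζ n ω) (x n ω) (y n ω) j * S.poisson (ζ n ω) (x n ω) l j)
  have h5 := abs_sub (S.poisson (ζ n ω) (x n ω) l (y (n + 1) ω))
    (∑ j, S.p (ζ n ω) (x n ω) (y n ω) j * S.poisson (ζ n ω) (x n ω) l j)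
  have h6 : 4 * (CN * |K.c₉|) * (K.c₁ * K.c₂ / K.c₃ * ((n : ℝ) + K.n₀) ^ K.κ₁) = 2 * c := by
    ring
  rw [h6, noise]
  linarith

theorem condExp_noise [IsProbabilityMeasure P] (hR : S.IsRun K P ℱ ζ x y M)
    (hS : S.Assumptions N K) (hK : K.Admissible) {CN : ℝ} (hCN : 0 < CN)
    (hN : ∀ v, ‖v‖ ≤ CN * N v) (n : ℕ) (l : Fin d) :
    P[S.noise ζ x y M l n | ℱ n] =ᵐ[P] 0 := by
  have hV : ∀ j, StronglyMeasurable[ℱ n] fun ω => S.poisson (ζ n ω) (x n ω) l j :=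
    fun j => (hR.measurable_poisson hS n l j).stronglyMeasurable
  obtain ⟨c, hc⟩ : ∃ c : ℝ, ∀ᵐ ω ∂P, ∀ l i, |S.poisson (ζ n ω) (x n ω) l i| ≤ c :=
    ⟨_, hR.ae_abs_poisson_le hS hK hCN hN n⟩
  have hVc : ∀ j, ∀ᵐ ω ∂P, ‖S.poisson (ζ n ω) (x n ω) l j‖ ≤ c := fun j => by
    filter_upwards [hc] with ω hω
    exact hω l j
  set I : Y → Ω → ℝ := fun j => {ω | y (n + 1) ω = j}.indicator fun _ => (1 : ℝ) with hI
  have hIint : ∀ j, Integrable (I j) P := fun j =>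
    (integrable_const 1).indicator (ℱ.le (n + 1) _ (hR.y_adapted (n + 1) j))
  set V : Y → Ω → ℝ := fun j ω => S.poisson (ζ n ω) (x n ω) l j with hVdef
  set p : Y → Ω → ℝ := fun j ω => S.p (ζ n ω) (x n ω) (y n ω) j with hp
  have hpm : ∀ j, StronglyMeasurable[ℱ n] (p j) :=
    fun j => (hR.measurable_transition n j).stronglyMeasurable
  have hp1 : ∀ j, ∀ᵐ ω ∂P, ‖p j ω‖ ≤ 1 := fun j => .of_forall fun ω => by
    have h := hS.p_stochastic _ (hR.ζ_mem n ω) _ (hR.x_mem n ω)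
    rw [Real.norm_eq_abs, abs_of_nonneg (Matrix.nonneg_of_mem_rowStochastic h)]
    exact Matrix.le_one_of_mem_rowStochastic h
  have hVI : ∀ j, Integrable (V j * I j) P := fun j =>
    (hIint j).bdd_mul ((hV j).mono (ℱ.le n)).aestronglyMeasurable (hVc j)
  have hVint : ∀ j, Integrable (V j) P := fun j =>
    .of_bound ((hV j).mono (ℱ.le n)).aestronglyMeasurable c (hVc j)
  have hpV : ∀ j, Integrable (p j * V j) P := fun j =>
    (hVint j).bdd_mul ((hpm j).mono (ℱ.le n)).aestronglyMeasurable (hp1 j)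
  have hMint : Integrable (fun ω => M (n + 1) ω l) P := by
    refine .of_bound (C := K.c₇) (Measurable.aestronglyMeasurable ?_) ?_
    · exact ((measurable_pi_apply l).comp (hR.M_adapted (n + 1))).mono (ℱ.le _) le_rfl
    · filter_upwards [hR.M_bound n] with ω hω
      exact hω l
  have hfun : S.noise ζ x y M l n
      = (fun ω => M (n + 1) ω l) + (∑ j, V j * I j - ∑ j, p j * V j) := by
    funext ω
    simp [noise, hVdef, hI, hp, Set.indicator_apply]
  have h1 : P[∑ j, V j * I j | ℱ n] =ᵐ[P] ∑ j, V j * p j := by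
    refine (condExp_finsetSum (fun j _ => hVI j) (ℱ n)).trans ?_
    have : ∀ᵐ ω ∂P, ∀ j, (P[V j * I j | ℱ n]) ω = V j ω * p j ω := by
      rw [ae_all_iff]
      intro j
      filter_upwards [condExp_mul_of_stronglyMeasurable_left (hV j) (hVI j) (hIint j),
        hR.markov n j] with ω h1 h2
      rw [h1, Pi.mul_apply, h2]
    filter_upwards [this] with ω hω
    simp [Finset.sum_apply, hω]
  have h2 : P[∑ j, p j * V j | ℱ n] = ∑ j, p j * V j := by
    refine condExp_of_stronglyMeasurable (ℱ.le n) ?_ (integrable_finsetSum' _ fun j _ => hpV j)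
    exact Finset.stronglyMeasurable_sum _ fun j _ => (hpm j).mul (hV j)
  have hi1 := integrable_finsetSum' Finset.univ fun j _ => hVI j
  have hi2 := integrable_finsetSum' Finset.univ fun j _ => hpV j
  rw [hfun]
  filter_upwards [condExp_add hMint (hi1.sub hi2) (ℱ n), condExp_sub hi1 hi2 (ℱ n), h1,
    hR.M_martingale_diff n l] with ω e1 e2 e3 e4
  rw [e1, Pi.add_apply, e2, Pi.sub_apply, e3, h2, e4]
  simp [Finset.sum_apply, mul_comm]

/-- Decomposition of the noise of the scheme: a martingale difference, a telescoping part and the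
drift of the Poisson solution. -/
theorem iteration_eq (hR : S.IsRun K P ℱ ζ x y M) (hS : S.Assumptions N K) (hK : K.Admissible)
    (n : ℕ) (ω : Ω) :
    x (n + 1) ω = x n ω + K.step n • (S.FBar (ζ n ω) (x n ω) (x n ω) - x n ω +
      ((fun l => S.noise ζ x y M l n ω) + (fun l => S.poisson (ζ n ω) (x n ω) l (y n ω)) -
        (fun l => S.poisson (ζ (n + 1) ω) (x (n + 1) ω) l (y (n + 1) ω)) +
        fun l => S.poisson (ζ (n + 1) ω) (x (n + 1) ω) l (y (n + 1) ω) -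
          S.poisson (ζ n ω) (x n ω) l (y (n + 1) ω))) := by
  refine (hR.iteration n ω).trans ?_
  congr 2
  funext l
  have h := hS.poisson_sub_sum hK (hR.ζ_mem n ω) (hR.x_mem n ω) l (y n ω)
  simp only [Pi.add_apply, Pi.sub_apply, noise]
  linarith

end IsRun

end SAModel

/-! ### Bounds for a run -/

namespace SAModel

variable {d d₁ : ℕ} {Y : Type*} [Fintype Y] [DecidableEq Y] {S : SAModel d d₁ Y}
  {K : SAConstants} {Ω : Type*} {ζ : ℕ → Ω → (Fin d₁ → ℝ)} {x : ℕ → Ω → (Fin d → ℝ)}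
  {y : ℕ → Ω → Y} {M : ℕ → Ω → (Fin d → ℝ)} {n₁ : ℕ}

/-- The average of the coordinate `l` of the noise with the stepsizes as weights, from the time
`n₁` on. -/
noncomputable def averagedNoise (S : SAModel d d₁ Y) (K : SAConstants) (n₁ : ℕ)
    (ζ : ℕ → Ω → (Fin d₁ → ℝ)) (x : ℕ → Ω → (Fin d → ℝ)) (y : ℕ → Ω → Y)
    (M : ℕ → Ω → (Fin d → ℝ)) (n : ℕ) (ω : Ω) (l : Fin d) : ℝ :=
  linearRec (fun n => 1 - K.step n) (fun n => if n < n₁ then 0 else K.step n)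
    (S.noise ζ x y M l) n ω

theorem averagedNoise_of_le {n : ℕ} (hn : n ≤ n₁) (ω : Ω) :
    averagedNoise S K n₁ ζ x y M n ω = 0 := by
  induction n with
  | zero => rfl
  | succ n ih =>
    funext l
    have := congrFun (ih (by omega)) l
    simp only [averagedNoise, Pi.zero_apply] at this
    simp [averagedNoise, linearRec, this, show n < n₁ by omega]

theorem averagedNoise_succ {n : ℕ} (hn : n₁ ≤ n) (ω : Ω) :
    averagedNoise S K n₁ ζ x y M (n + 1) ω = (1 - K.step n) • averagedNoise S K n₁ ζ x y M n ω +
      K.step n • fun l => S.noise ζ x y M l n ω := by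
  funext l
  simp [averagedNoise, linearRec, show ¬ n < n₁ by omega]

end SAModel

namespace SAModel.IsRun

variable {d d₁ : ℕ} {Y : Type*} [Fintype Y] [DecidableEq Y]
  {S : SAModel d d₁ Y} {N : Seminorm ℝ (Fin d → ℝ)} {K : SAConstants} {Ω : Type*}
  [mΩ : MeasurableSpace Ω] {P : Measure Ω} {ℱ : Filtration ℕ mΩ} {ζ : ℕ → Ω → (Fin d₁ → ℝ)}
  {x : ℕ → Ω → (Fin d → ℝ)} {y : ℕ → Ω → Y} {M : ℕ → Ω → (Fin d → ℝ)}
  {r ε : ℝ} {n₁ : ℕ} {CN CN' : ℝ}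

theorem ae_increment_le (hR : S.IsRun K P ℱ ζ x y M) (hS : S.Assumptions N K)
    (hK : K.Admissible) (hCN : 0 < CN) (hN : ∀ v, N v ≤ CN * ‖v‖) (n : ℕ) :
    ∀ᵐ ω ∂P, N (x (n + 1) ω - x n ω) ≤
      K.β * (|K.c₉| + |K.c₈| + CN * |K.c₇|) * ((n : ℝ) + K.n₀) ^ (-(1 - K.𝔞)) := by
  filter_upwards [hR.M_bound n] with ω hM
  have hM' : ‖M (n + 1) ω‖ ≤ |K.c₇| :=
    (pi_norm_le_iff_of_nonneg (abs_nonneg _)).2 fun l => (hM l).trans (le_abs_self _)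
  have h1 : N (S.F (x n ω) (y n ω) - x n ω + M (n + 1) ω) ≤ |K.c₉| + |K.c₈| + CN * |K.c₇| := by
    have h2 := map_add_le_add N (S.F (x n ω) (y n ω) - x n ω) (M (n + 1) ω)
    have h3 := map_sub_le_add N (S.F (x n ω) (y n ω)) (x n ω)
    have h4 := (hS.F_bound _ (hR.x_mem n ω) (y n ω)).trans (le_abs_self _)
    have h5 := (hS.X_bound _ (hR.x_mem n ω)).trans (le_abs_self _)
    have h6 := (hN (M (n + 1) ω)).trans (mul_le_mul_of_nonneg_left hM' hCN.le)
    linarith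
  rw [hR.iteration n ω, add_sub_cancel_left, map_smul_eq_mul, Real.norm_eq_abs,
    abs_of_pos (K.step_pos hK n)]
  refine (mul_le_mul_of_nonneg_left h1 (K.step_pos hK n).le).trans_eq ?_
  rw [K.step_eq hK]
  ring

/-- The Poisson solution moves slowly along a run. The logarithm in the sensitivity of the
transition matrix is absorbed in the power `1 - 3 κ₁ - driftExp - r`. -/
theorem ae_abs_poisson_sub_le (hR : S.IsRun K P ℱ ζ x y M) (hS : S.Assumptions N K)
    (hK : K.Admissible) (h : K.IsRate r ε n₁) (hCN : 0 < CN) (hN : ∀ v, N v ≤ CN * ‖v‖)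
    (hCN' : 0 < CN') (hN' : ∀ v, ‖v‖ ≤ CN' * N v) {D η H Φ : ℝ}
    (hD : D = K.β * (|K.c₉| + |K.c₈| + CN * |K.c₇|)) (hη : η = 1 - 3 * K.κ₁ - K.driftExp - r)
    (hH : H = K.c₁ * K.c₂ / K.c₃) (hΦ : Φ = CN' * |K.c₉|) {n : ℕ} (hn : n₁ ≤ n) :
    ∀ᵐ ω ∂P, ∀ l i,
      |S.poisson (ζ (n + 1) ω) (x (n + 1) ω) l i - S.poisson (ζ n ω) (x n ω) l i| ≤
        4 * H * (|K.c₆| * D + 2 * (K.c₄ + K.c₅ * D / η) * Φ * H) *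
          ((n : ℝ) + K.n₀) ^ (-(r + K.κ₁)) := by
  have hw1 := h.one_le n hn
  set w := (n : ℝ) + K.n₀ with hw
  have hw0 : 0 < w := by linarith
  have hsucc : ((n + 1 : ℕ) : ℝ) + K.n₀ = w + 1 := by rw [hw]; push_cast; ring
  have hη0 : 0 < η := by rw [hη]; linarith [h.lt_drift]
  have hc₁ := hK.c₁_pos
  have hc₂ := hK.c₂_pos
  have hc₃ := hK.c₃_pos
  have hc₄ := hK.c₄_pos
  have hc₅ := hK.c₅_pos
  have hβ := hK.β_pos
  have hκ := hK.κ₁_mem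
  have hκ₃ := hK.κ₃_mem.1
  have hD0 : 0 ≤ D := by rw [hD]; positivity
  have hH0 : 0 ≤ H := by rw [hH]; positivity
  have hΦ0 : 0 ≤ Φ := by rw [hΦ]; positivity
  have hm₁ : K.𝔞 + K.κ₃ ≤ K.driftExp := le_max_left _ _
  have hm₂ : K.κ₂ ≤ K.driftExp := le_max_right _ _
  set q := K.driftExp + η - 1 with hq
  have hwq : 0 ≤ w ^ q := Real.rpow_nonneg hw0.le _
  have hwκ : 0 ≤ w ^ K.κ₁ := Real.rpow_nonneg hw0.le _
  filter_upwards [hR.ae_increment_le hS hK hCN hN n, hR.contraction_rate n,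
    hR.contraction_rate (n + 1), hR.temporal_smoothness n, hR.iterate_sensitivity n]
    with ω hinc hα hα' htemp hsens l i
  rw [hsucc] at hα'
  rw [← hD] at hinc
  have hE : ∀ i, ∑ j, |S.p (ζ (n + 1) ω) (x (n + 1) ω) i j - S.p (ζ n ω) (x n ω) i j| ≤
      (K.c₄ + K.c₅ * D / η) * w ^ q := by
    intro i
    have h1 := htemp _ (hR.x_mem (n + 1) ω) i
    have h2 := hS.p_lipschitz _ (hR.ζ_mem n ω) _ (hR.x_mem (n + 1) ω) _ (hR.x_mem n ω) i
    have h3 : ∑ j, |S.p (ζ (n + 1) ω) (x (n + 1) ω) i j - S.p (ζ n ω) (x n ω) i j| ≤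
        ∑ j, |S.p (ζ n ω) (x (n + 1) ω) i j - S.p (ζ (n + 1) ω) (x (n + 1) ω) i j| +
        ∑ j, |S.p (ζ n ω) (x (n + 1) ω) i j - S.p (ζ n ω) (x n ω) i j| := by
      rw [← Finset.sum_add_distrib]
      refine Finset.sum_le_sum fun j _ => ?_
      rw [abs_sub_comm (S.p (ζ n ω) (x (n + 1) ω) i j)]
      exact abs_sub_le _ _ _
    have h4 : K.c₄ / w ^ (1 - K.κ₂) ≤ K.c₄ * w ^ q := by
      rw [div_eq_mul_inv, ← Real.rpow_neg hw0.le]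
      exact mul_le_mul_of_nonneg_left
        (Real.rpow_le_rpow_of_exponent_le hw1 (by linarith)) hc₄.le
    have h5 : S.L₂ (ζ n ω) * N (x (n + 1) ω - x n ω) ≤ K.c₅ * D / η * w ^ q := by
      have hlog : Real.log w ≤ w ^ η / η := Real.log_le_rpow_div hw0.le hη0
      have hwκ₃ : 0 ≤ w ^ K.κ₃ := Real.rpow_nonneg hw0.le _
      have hL : S.L₂ (ζ n ω) ≤ K.c₅ * w ^ K.κ₃ * (w ^ η / η) :=
        hsens.trans (mul_le_mul_of_nonneg_left hlog (mul_nonneg hc₅.le hwκ₃))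
      calc S.L₂ (ζ n ω) * N (x (n + 1) ω - x n ω)
          ≤ K.c₅ * w ^ K.κ₃ * (w ^ η / η) * (D * w ^ (-(1 - K.𝔞))) :=
            mul_le_mul hL hinc (apply_nonneg N _) (by positivity)
        _ = K.c₅ * D / η * w ^ (K.κ₃ + η + -(1 - K.𝔞)) := by
            rw [Real.rpow_add hw0, Real.rpow_add hw0]
            ring
        _ ≤ _ := mul_le_mul_of_nonneg_left
            (Real.rpow_le_rpow_of_exponent_le hw1 (by linarith)) (by positivity)
    linarith
  have hΔ : N (x (n + 1) ω - x n ω) ≤ D * w ^ (q + K.κ₁) :=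
    hinc.trans (mul_le_mul_of_nonneg_left
      (Real.rpow_le_rpow_of_exponent_le hw1 (by linarith [hκ.1])) hD0)
  refine (hS.abs_poisson_sub_le hK hCN' hN' hw0 (show 0 < w + 1 by linarith) (hR.ζ_mem n ω)
    (hR.ζ_mem (n + 1) ω) hα hα' (hR.x_mem n ω) (hR.x_mem (n + 1) ω) hΔ hE l i).trans ?_
  rw [← hΦ, ← hH]
  have hexp : w ^ (-(r + K.κ₁)) = w ^ (q + K.κ₁) * w ^ K.κ₁ := by
    rw [← Real.rpow_add hw0]
    congr 1
    rw [hq, hη]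
    ring
  have hpow := Real.rpow_add hw0 q K.κ₁
  have hwqκ : 0 ≤ w ^ (q + K.κ₁) := Real.rpow_nonneg hw0.le _
  calc _ ≤ (2 * (|K.c₆| * (D * w ^ (q + K.κ₁))) +
          2 * ((K.c₄ + K.c₅ * D / η) * w ^ q * (2 * Φ * (H * w ^ K.κ₁)))) *
          (H * (2 * w ^ K.κ₁)) := by
        refine mul_le_mul_of_nonneg_left ?_ (by positivity)
        exact mul_le_mul_of_nonneg_left (add_one_rpow_le_two_mul hw1 hκ.1 hκ.2) hH0
    _ = _ := by
        rw [hexp, hpow]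
        ring

/-- Simultaneous concentration of the averaged noise, at all times and in all coordinates; the
failure probability at time `n` is `δ / n ^ 2` per coordinate. -/
theorem measure_averagedNoise_le [IsProbabilityMeasure P] (hR : S.IsRun K P ℱ ζ x y M)
    (hS : S.Assumptions N K) (hK : K.Admissible) (h : K.IsRate r ε n₁) (hCN' : 0 < CN')
    (hN' : ∀ v, ‖v‖ ≤ CN' * N v) {b σ : ℝ}
    (hb : b = |K.c₇| + 4 * (CN' * |K.c₉|) * (K.c₁ * K.c₂ / K.c₃))
    (hσ : σ = K.β * b ^ 2 / ε + 1) {δ : ℝ} (hδ : 0 < δ) (hδ₁ : δ ≤ 1) :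
    P {ω | ∃ n, (1 ≤ n ∧ n₁ ≤ n) ∧ ∃ l,
      Real.sqrt (2 * (σ * ((n : ℝ) + K.n₀) ^ (-(2 * (r + K.κ₁)))) *
        Real.log (2 * (n : ℝ) ^ 2 / δ)) < |averagedNoise S K n₁ ζ x y M n ω l|} ≤
      ENNReal.ofReal (Real.pi ^ 2 * d / 6 * δ) := by
  have hc₁ := hK.c₁_pos
  have hc₂ := hK.c₂_pos
  have hc₃ := hK.c₃_pos
  have hn₀ := hK.n₀_pos
  have hβ := hK.β_pos
  have hε := h.ε_pos
  have hσ0 : 0 < σ := by rw [hσ]; positivity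
  set U : ℕ → Fin d → Set Ω := fun n l => {ω | (1 ≤ n ∧ n₁ ≤ n) ∧
    Real.sqrt (2 * (σ * ((n : ℝ) + K.n₀) ^ (-(2 * (r + K.κ₁)))) *
      Real.log (2 * (n : ℝ) ^ 2 / δ)) < |averagedNoise S K n₁ ζ x y M n ω l|} with hU
  have hUle : ∀ n l, P (U n l) ≤ ENNReal.ofReal (δ * (1 / (n : ℝ) ^ 2)) := by
    intro n l
    by_cases hn : 1 ≤ n ∧ n₁ ≤ n
    · have hw : 0 < (n : ℝ) + K.n₀ := by positivity
      have hn1 : (1 : ℝ) ≤ n := by exact_mod_cast hn.1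
      have hsub := hasSubgaussianMGF_linearRec (fun n => 1 - K.step n)
        (fun n => if n < n₁ then 0 else K.step n)
        (fun n => (hR.measurable_noise hS n l).stronglyMeasurable)
        (fun n => hR.ae_abs_noise_le hS hK hCN' hN' n l)
        (fun n => hR.condExp_noise hS hK hCN' hN' n l) n
      have hvar := h.linearRecVar_le hK (b := b) (b' := fun n : ℕ => |K.c₇| +
        4 * (CN' * |K.c₉|) * (K.c₁ * K.c₂ / K.c₃ * ((n : ℝ) + K.n₀) ^ K.κ₁))
        (fun n => by positivity) (fun n hn => by
          have h1 : 1 ≤ ((n : ℝ) + K.n₀) ^ K.κ₁ :=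
            Real.one_le_rpow (h.one_le n hn) hK.κ₁_mem.1
          have h2 := mul_le_mul_of_nonneg_left h1 (abs_nonneg K.c₇)
          rw [hb]
          linarith) hn.2
      rw [← hσ] at hvar
      have hlog : 0 ≤ Real.log (2 * (n : ℝ) ^ 2 / δ) := by
        refine Real.log_nonneg ?_
        rw [le_div_iff₀ hδ]
        nlinarith
      have htail := measure_lt_abs_le_of_hasSubgaussianMGF hsub
        (σ := σ * ((n : ℝ) + K.n₀) ^ (-(2 * (r + K.κ₁))))
        (mul_pos hσ0 (Real.rpow_pos_of_pos hw _))
        (by rwa [Real.coe_toNNReal _ (linearRecVar_nonneg _ _ _ _)]) hlog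
      have heq : 2 * Real.exp (-Real.log (2 * (n : ℝ) ^ 2 / δ)) = δ * (1 / (n : ℝ) ^ 2) := by
        rw [Real.exp_neg, Real.exp_log (by positivity)]
        field_simp
      rw [heq] at htail
      exact (measure_mono fun ω hω => hω.2).trans htail
    · have : U n l = ∅ := by
        ext ω
        simp [hU, hn]
      simp [this]
  have hcover : {ω | ∃ n, (1 ≤ n ∧ n₁ ≤ n) ∧ ∃ l,
      Real.sqrt (2 * (σ * ((n : ℝ) + K.n₀) ^ (-(2 * (r + K.κ₁)))) *
        Real.log (2 * (n : ℝ) ^ 2 / δ)) < |averagedNoise S K n₁ ζ x y M n ω l|}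
      ⊆ ⋃ l, ⋃ n, U n l := by
    rintro ω ⟨n, hn, l, hl⟩
    exact Set.mem_iUnion.2 ⟨l, Set.mem_iUnion.2 ⟨n, hn, hl⟩⟩
  have hsum : HasSum (fun n : ℕ => δ * (1 / (n : ℝ) ^ 2)) (δ * (Real.pi ^ 2 / 6)) :=
    hasSum_zeta_two.mul_left δ
  have hUl : ∀ l, P (⋃ n, U n l) ≤ ENNReal.ofReal (δ * (Real.pi ^ 2 / 6)) := by
    intro l
    refine (measure_iUnion_le _).trans ((ENNReal.tsum_le_tsum fun n => hUle n l).trans_eq ?_)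
    rw [← ENNReal.ofReal_tsum_of_nonneg (fun n => by positivity) hsum.summable, hsum.tsum_eq]
  refine (measure_mono hcover).trans ((measure_iUnion_le _).trans ?_)
  rw [tsum_fintype]
  refine (Finset.sum_le_sum fun l _ => hUl l).trans_eq ?_
  rw [Finset.sum_const, Finset.card_univ, Fintype.card_fin, nsmul_eq_mul,
    ← ENNReal.ofReal_natCast, ← ENNReal.ofReal_mul (by positivity)]
  congr 1
  ring

end SAModel.IsRun

/-! ### The high-probability bound and convergence -/

theorem inv_four_le_log_div {d n : ℕ} (hd : 1 ≤ d) (hn : 1 ≤ n) {δ : ℝ} (hδ : 0 < δ)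
    (hδ₁ : Real.pi ^ 2 * d / 6 * δ < 1) : 1 / 4 ≤ Real.log ((n : ℝ) ^ 2 / δ) := by
  have hd' : (1 : ℝ) ≤ d := by exact_mod_cast hd
  have hn' : (1 : ℝ) ≤ n := by exact_mod_cast hn
  have h1 : (3 / 2 : ℝ) ≤ (n : ℝ) ^ 2 / δ := by
    rw [le_div_iff₀ hδ]
    have h2 : 9 ≤ Real.pi ^ 2 := by nlinarith [Real.pi_gt_three]
    have h3 : 9 * 1 ≤ Real.pi ^ 2 * d := mul_le_mul h2 hd' zero_le_one (by positivity)
    nlinarith [mul_le_mul_of_nonneg_right h3 hδ.le]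
  have h2 := Real.one_sub_inv_le_log_of_pos (show (0 : ℝ) < 3 / 2 by norm_num)
  have h3 := Real.log_le_log (by norm_num) h1
  norm_num at h2
  linarith

theorem sqrt_variance_mul_log_le {σ w q δ : ℝ} (hσ : 0 < σ) (hw : 0 < w) (hδ : 0 < δ) {k n : ℕ}
    (hk : 1 ≤ k) (hkn : k ≤ n) :
    Real.sqrt (2 * (σ * w ^ (-(2 * q))) * Real.log (2 * (k : ℝ) ^ 2 / δ)) ≤
      Real.sqrt (2 * σ * Real.log (2 * (n : ℝ) ^ 2 / δ)) * w ^ (-q) := by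
  have hk1 : (1 : ℝ) ≤ k := by exact_mod_cast hk
  have hmono : Real.log (2 * (k : ℝ) ^ 2 / δ) ≤ Real.log (2 * (n : ℝ) ^ 2 / δ) := by
    refine Real.log_le_log (by positivity) ?_
    gcongr
  have hpow : w ^ (-(2 * q)) = (w ^ (-q)) ^ 2 := by
    rw [← Real.rpow_mul_natCast hw.le]
    congr 1
    push_cast
    ring
  calc _ ≤ Real.sqrt (2 * σ * Real.log (2 * (n : ℝ) ^ 2 / δ) * (w ^ (-q)) ^ 2) := by
        refine Real.sqrt_le_sqrt ?_
        rw [hpow]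
        have := mul_le_mul_of_nonneg_left hmono (show 0 ≤ 2 * σ * (w ^ (-q)) ^ 2 by positivity)
        linarith
    _ = _ := by
        rw [Real.sqrt_mul' _ (sq_nonneg _), Real.sqrt_sq (Real.rpow_nonneg hw.le _)]

/-- Absorbs the terms `u` and `v` of a bound into a factor `t` that is bounded below. -/
theorem two_mul_add_le_mul {a G u v s t : ℝ} (ha : 0 ≤ a) (hu : 0 ≤ u) (hv : 0 ≤ v)
    (hG : G ≤ s * t) (ht : 1 ≤ 2 * t) :
    2 * (a * (G + u) + v) ≤ 2 * (a * (s + 2 * u) + 2 * v) * t := by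
  have h1 := mul_le_mul_of_nonneg_left ht hu
  have h2 := mul_le_mul_of_nonneg_left ht hv
  have h3 := mul_le_mul_of_nonneg_left (show G + u ≤ (s + 2 * u) * t by linarith) ha
  linarith

namespace SAModel

theorem FBar_sub_xStar_le {d d₁ : ℕ} {Y : Type*} [Fintype Y] [DecidableEq Y]
    {S : SAModel d d₁ Y} {N : Seminorm ℝ (Fin d → ℝ)} {K : SAConstants} (hS : S.Assumptions N K)
    {ζ : Fin d₁ → ℝ} (hζ : ζ ∈ S.Z) {x : Fin d → ℝ} (hx : x ∈ S.X) :
    N (S.FBar ζ x x - S.xStar) ≤ S.α ζ * N (x - S.xStar) := by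
  have h := hS.FBar_contraction ζ hζ x hx x hx S.xStar hS.xStar_mem
  rwa [hS.FBar_xStar ζ hζ x hx] at h

/-- Uniform high-probability bound at some positive rate `n ^ (-r)` that is at least the rate
asked for. -/
theorem exists_measure_not_le {d d₁ : ℕ} (N : Seminorm ℝ (Fin d → ℝ)) (hN : ∀ v, N v = 0 → v = 0)
    (K : SAConstants) (hK : K.Admissible) (hd : 1 ≤ d) :
    ∃ r C : ℝ, 0 < r ∧ 1 / 2 - 2 * K.κ₁ - K.driftExp ≤ r ∧ 0 < C ∧
      ∀ (Y : Type*) [Fintype Y] [DecidableEq Y] (S : SAModel d d₁ Y), S.Assumptions N K →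
      ∀ (Ω : Type*) [mΩ : MeasurableSpace Ω] (P : Measure Ω) [IsProbabilityMeasure P]
        (ℱ : Filtration ℕ mΩ) (ζ : ℕ → Ω → (Fin d₁ → ℝ)) (x : ℕ → Ω → (Fin d → ℝ))
        (y : ℕ → Ω → Y) (M : ℕ → Ω → (Fin d → ℝ)), S.IsRun K P ℱ ζ x y M →
        ∀ δ : ℝ, 0 < δ → Real.pi ^ 2 * d / 6 * δ < 1 →
          P {ω | ¬ ∀ n : ℕ, 1 ≤ n → N (x n ω - S.xStar) ≤
            C * (Real.sqrt (Real.log ((n : ℝ) ^ 2 / δ)) * (n : ℝ) ^ (-r))} ≤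
          ENNReal.ofReal (Real.pi ^ 2 * d / 6 * δ) := by
  obtain ⟨CN, hCN, hNle⟩ := N.exists_le_mul_norm
  obtain ⟨CN', hCN', hNle'⟩ := N.exists_norm_le_mul hN
  obtain ⟨r, ε, n₁, h⟩ := K.exists_isRate hK
  have hc₁ := hK.c₁_pos
  have hc₂ := hK.c₂_pos
  have hc₃ := hK.c₃_pos
  have hc₄ := hK.c₄_pos
  have hc₅ := hK.c₅_pos
  have hn₀ := hK.n₀_pos
  have hβ := hK.β_pos
  have hε := h.ε_pos
  have hr := h.pos
  have hκ := hK.κ₁_mem.1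
  obtain ⟨b, hb⟩ : ∃ b, b = |K.c₇| + 4 * (CN' * |K.c₉|) * (K.c₁ * K.c₂ / K.c₃) := ⟨_, rfl⟩
  obtain ⟨σ, hσ⟩ : ∃ σ, σ = K.β * b ^ 2 / ε + 1 := ⟨_, rfl⟩
  obtain ⟨D, hD⟩ : ∃ D, D = K.β * (|K.c₉| + |K.c₈| + CN * |K.c₇|) := ⟨_, rfl⟩
  obtain ⟨η, hη⟩ : ∃ η, η = 1 - 3 * K.κ₁ - K.driftExp - r := ⟨_, rfl⟩
  obtain ⟨H, hH⟩ : ∃ H, H = K.c₁ * K.c₂ / K.c₃ := ⟨_, rfl⟩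
  obtain ⟨Φ, hΦ⟩ : ∃ Φ, Φ = CN' * |K.c₉| := ⟨_, rfl⟩
  obtain ⟨b', hb'⟩ : ∃ b', b' = 2 * Φ * H +
    4 * H * (|K.c₆| * D + 2 * (K.c₄ + K.c₅ * D / η) * Φ * H) := ⟨_, rfl⟩
  have hη0 : 0 < η := by rw [hη]; linarith [h.lt_drift]
  have hσ0 : 0 < σ := by rw [hσ]; positivity
  have hD0 : 0 ≤ D := by rw [hD]; positivity
  have hH0 : 0 ≤ H := by rw [hH]; positivity
  have hΦ0 : 0 ≤ Φ := by rw [hΦ]; positivity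
  have hb'0 : 0 ≤ b' := by rw [hb']; positivity
  have hb'1 : 2 * Φ * H ≤ b' := by rw [hb']; exact le_add_of_nonneg_right (by positivity)
  have hb'2 : 4 * H * (|K.c₆| * D + 2 * (K.c₄ + K.c₅ * D / η) * Φ * H) ≤ b' := by
    rw [hb']; exact le_add_of_nonneg_left (by positivity)
  -- The bound at time `n` is affine in `G = √(2 σ log (2 n ^ 2 / δ))`. As `log (n ^ 2 / δ)` is
  -- bounded below, `√(log (n ^ 2 / δ))` dominates both `G` and the constant term. The term with
  -- `n₁ ^ r` covers the times before `n₁`.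
  obtain ⟨C₀, hC₀⟩ : ∃ C₀, C₀ = 2 * (CN / K.c₃ / ε *
    (Real.sqrt (8 * σ) + 2 * ((2 * K.β + 3) * b')) +
      2 * ((2 * |K.c₈| + CN * K.β * b') * (n₁ + K.n₀))) := ⟨_, rfl⟩
  have hC₀0 : 0 ≤ C₀ := by rw [hC₀]; positivity
  refine ⟨r, C₀ + 4 * |K.c₈| * (n₁ : ℝ) ^ r + 1, hr, h.target_le, by positivity, ?_⟩
  intro Y _ _ S hS Ω mΩ P _ ℱ ζ x y M hR δ hδ hδ₁
  have hδ1 : δ ≤ 1 := by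
    have hd' : (1 : ℝ) ≤ d := by exact_mod_cast hd
    have h2 : 9 ≤ Real.pi ^ 2 := by nlinarith [Real.pi_gt_three]
    have h3 : 9 * 1 ≤ Real.pi ^ 2 * d := mul_le_mul h2 hd' zero_le_one (by positivity)
    nlinarith [mul_le_mul_of_nonneg_right h3 hδ.le]
  refine le_trans (measure_mono_ae ?_)
    (hR.measure_averagedNoise_le hS hK h hCN' hNle' hb hσ hδ hδ1)
  have hdiam : ∀ n ω, N (x n ω - S.xStar) ≤ 2 * |K.c₈| := fun n ω => by
    have h1 := map_sub_le_add N (x n ω) S.xStar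
    have h2 := (hS.X_bound _ (hR.x_mem n ω)).trans (le_abs_self _)
    have h3 := (hS.X_bound _ hS.xStar_mem).trans (le_abs_self _)
    linarith
  filter_upwards [ae_all_iff.2 fun n => hR.ae_abs_poisson_le hS hK hCN' hNle' n,
    ae_all_iff.2 hR.contraction_rate,
    ae_all_iff.2 fun n => (ae_all_iff (α := Ω)).2 fun hn : n₁ ≤ n =>
      hR.ae_abs_poisson_sub_le hS hK h hCN hNle hCN' hNle' hD hη hH hΦ hn] with ω hV hα hdrift hω
  by_contra hgood
  refine hω fun n hn => ?_
  have hgood' : ∀ k : ℕ, 1 ≤ k → n₁ ≤ k → ∀ l, |averagedNoise S K n₁ ζ x y M k ω l| ≤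
      Real.sqrt (2 * (σ * ((k : ℝ) + K.n₀) ^ (-(2 * (r + K.κ₁)))) *
        Real.log (2 * (k : ℝ) ^ 2 / δ)) := by
    intro k hk hk' l
    by_contra hl
    exact hgood ⟨k, ⟨hk, hk'⟩, l, not_le.1 hl⟩
  have hn' : (1 : ℝ) ≤ n := by exact_mod_cast hn
  have hn0 : (0 : ℝ) < n := by linarith
  set L := Real.log ((n : ℝ) ^ 2 / δ) with hL
  have hL4 : 1 / 4 ≤ L := inv_four_le_log_div hd hn hδ hδ₁
  have hsq : 1 ≤ 2 * Real.sqrt L := by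
    have h1 : (1 / 2 : ℝ) ≤ Real.sqrt L := Real.le_sqrt_of_sq_le (by linarith)
    linarith
  have hnr : 0 < (n : ℝ) ^ (-r) := Real.rpow_pos_of_pos hn0 _
  have hLn : 0 ≤ Real.sqrt L * (n : ℝ) ^ (-r) := by positivity
  rcases le_total n₁ n with hnn | hnn
  · have hlog2 : Real.log (2 * (n : ℝ) ^ 2 / δ) ≤ 4 * L := by
      rw [mul_div_assoc, Real.log_mul two_ne_zero (by positivity)]
      linarith [Real.log_two_lt_d9]
    obtain ⟨G, hG⟩ : ∃ G, G = Real.sqrt (2 * σ * Real.log (2 * (n : ℝ) ^ 2 / δ)) := ⟨_, rfl⟩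
    have hGle : G ≤ Real.sqrt (8 * σ) * Real.sqrt L := by
      rw [hG, ← Real.sqrt_mul (by positivity)]
      refine Real.sqrt_le_sqrt ?_
      have := mul_le_mul_of_nonneg_left hlog2 hσ0.le
      linarith
    have hA : ∀ k, n₁ ≤ k → k ≤ n → ‖averagedNoise S K n₁ ζ x y M k ω‖ ≤
        G * ((k : ℝ) + K.n₀) ^ (-(r + K.κ₁)) := by
      intro k hk hkn
      have hw : 0 < (k : ℝ) + K.n₀ := by positivity
      rw [hG]
      have hpos : 0 ≤ Real.sqrt (2 * σ * Real.log (2 * (n : ℝ) ^ 2 / δ)) *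
          ((k : ℝ) + K.n₀) ^ (-(r + K.κ₁)) :=
        mul_nonneg (Real.sqrt_nonneg _) (Real.rpow_nonneg hw.le _)
      rcases Nat.eq_zero_or_pos k with h0 | h0
      · rw [averagedNoise_of_le (by omega), norm_zero]
        exact hpos
      refine (pi_norm_le_iff_of_nonneg hpos).2 fun l => (hgood' k h0 hk l).trans ?_
      exact sqrt_variance_mul_log_le hσ0 hw hδ h0 hkn
    have hbound := h.dist_le hK hCN hNle (T := n) (α := fun k => S.α (ζ k ω))
      (x := fun k => x k ω) (f := fun k => S.FBar (ζ k ω) (x k ω) (x k ω))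
      (ξ := fun k l => S.noise ζ x y M l k ω)
      (W := fun k l => S.poisson (ζ k ω) (x k ω) l (y k ω))
      (e := fun k l => S.poisson (ζ (k + 1) ω) (x (k + 1) ω) l (y (k + 1) ω) -
        S.poisson (ζ k ω) (x k ω) l (y (k + 1) ω))
      (A := fun k => averagedNoise S K n₁ ζ x y M k ω) (xs := S.xStar) (D := 2 * |K.c₈|) (G := G)
      hb'0 (fun k _ => hR.iteration_eq hS hK k ω) (averagedNoise_of_le le_rfl ω)
      (fun k hk => averagedNoise_succ hk ω)
      (fun k _ => FBar_sub_xStar_le hS (hR.ζ_mem k ω) (hR.x_mem k ω))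
      (fun k => (hS.α_mem _ (hR.ζ_mem k ω)).1) (fun k _ => hα k)
      (fun k hk => ?_) (fun k hk => ?_) hA (hdiam n₁ ω) hnn le_rfl
    · refine hbound.trans ?_
      have hwr : ((n : ℝ) + K.n₀) ^ (-r) ≤ (n : ℝ) ^ (-r) :=
        Real.rpow_le_rpow_of_nonpos hn0 (by linarith) (by linarith)
      have hwr0 : 0 ≤ ((n : ℝ) + K.n₀) ^ (-r) := Real.rpow_nonneg (by linarith) _
      have h1 : 2 * (CN * (G + (2 * K.β + 3) * b') / K.c₃ / ε +
          (2 * |K.c₈| + CN * K.β * b') * (n₁ + K.n₀)) ≤ C₀ * Real.sqrt L := by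
        have e := two_mul_add_le_mul (a := CN / K.c₃ / ε) (u := (2 * K.β + 3) * b')
          (v := (2 * |K.c₈| + CN * K.β * b') * (n₁ + K.n₀)) (by positivity) (by positivity)
          (by positivity) hGle hsq
        rw [← hC₀] at e
        refine Eq.trans_le ?_ e
        ring
      have h2 : C₀ * Real.sqrt L * ((n : ℝ) + K.n₀) ^ (-r) ≤ C₀ * Real.sqrt L * (n : ℝ) ^ (-r) :=
        mul_le_mul_of_nonneg_left hwr (mul_nonneg hC₀0 (Real.sqrt_nonneg L))
      have h3 := mul_le_mul_of_nonneg_right h1 hwr0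
      have h4 : 0 ≤ (4 * |K.c₈| * (n₁ : ℝ) ^ r + 1) * (Real.sqrt L * (n : ℝ) ^ (-r)) := by
        positivity
      linarith
    · have hw : 0 < (k : ℝ) + K.n₀ := by positivity
      have hwκ : 0 ≤ ((k : ℝ) + K.n₀) ^ K.κ₁ := Real.rpow_nonneg hw.le _
      refine (pi_norm_le_iff_of_nonneg (by positivity)).2 fun l => (hV k l _).trans ?_
      rw [← hΦ, ← hH, ← mul_assoc]
      exact mul_le_mul_of_nonneg_right hb'1 hwκ
    · have hw : 0 < (k : ℝ) + K.n₀ := by positivity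
      have hwκ : 0 ≤ ((k : ℝ) + K.n₀) ^ (-(r + K.κ₁)) := Real.rpow_nonneg hw.le _
      refine (pi_norm_le_iff_of_nonneg (by positivity)).2 fun l => (hdrift k hk l _).trans ?_
      exact mul_le_mul_of_nonneg_right hb'2 hwκ
  · have h1 : 1 ≤ (n₁ : ℝ) ^ r * (n : ℝ) ^ (-r) := by
      rw [Real.rpow_neg hn0.le, ← div_eq_mul_inv, one_le_div (Real.rpow_pos_of_pos hn0 _)]
      exact Real.rpow_le_rpow hn0.le (by exact_mod_cast hnn) hr.le
    have h2 : 1 * 1 ≤ 2 * Real.sqrt L * ((n₁ : ℝ) ^ r * (n : ℝ) ^ (-r)) :=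
      mul_le_mul hsq h1 zero_le_one (by positivity)
    have h3 := mul_le_mul_of_nonneg_left h2 (show 0 ≤ 2 * |K.c₈| by positivity)
    have h4 := mul_nonneg hC₀0 hLn
    linarith [hdiam n ω]

end SAModel

theorem tendsto_sqrt_log_mul_rpow_neg {δ r : ℝ} (hδ : 0 < δ) (hr : 0 < r) :
    Tendsto (fun n : ℕ => Real.sqrt (Real.log ((n : ℝ) ^ 2 / δ)) * (n : ℝ) ^ (-r)) atTop
      (𝓝 0) := by
  have h1 : Tendsto (fun t : ℝ => Real.log t * t ^ (-(2 * r))) atTop (𝓝 0) := by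
    refine (isLittleO_log_rpow_atTop (show 0 < 2 * r by positivity)).tendsto_div_nhds_zero.congr' ?_
    filter_upwards [eventually_gt_atTop 0] with t ht
    rw [Real.rpow_neg ht.le, div_eq_mul_inv]
  have h2 : Tendsto (fun t : ℝ => t ^ (-(2 * r))) atTop (𝓝 0) :=
    tendsto_rpow_neg_atTop (by positivity)
  have h3 : Tendsto (fun t : ℝ => Real.log (t ^ 2 / δ) * t ^ (-(2 * r))) atTop (𝓝 0) := by
    have h4 := (h1.const_mul 2).sub (h2.const_mul (Real.log δ))
    rw [mul_zero, mul_zero, sub_zero] at h4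
    refine h4.congr' ?_
    filter_upwards [eventually_gt_atTop 0] with t ht
    rw [Real.log_div (by positivity) hδ.ne', Real.log_pow]
    push_cast
    ring
  have h5 := (Real.continuous_sqrt.tendsto 0).comp (h3.comp tendsto_natCast_atTop_atTop)
  rw [Real.sqrt_zero] at h5
  refine h5.congr fun n => ?_
  have hn : (0 : ℝ) ≤ n := n.cast_nonneg
  simp only [Function.comp_apply]
  rw [mul_comm, Real.sqrt_mul (Real.rpow_nonneg hn _), mul_comm]
  congr 1
  rw [Real.sqrt_eq_rpow, ← Real.rpow_mul hn]
  congr 1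
  ring

theorem Seminorm.tendsto_of_tendsto_sub {d : ℕ} (N : Seminorm ℝ (Fin d → ℝ))
    (hN : ∀ v, N v = 0 → v = 0) {u : ℕ → Fin d → ℝ} {a : Fin d → ℝ}
    (h : Tendsto (fun n => N (u n - a)) atTop (𝓝 0)) : Tendsto u atTop (𝓝 a) := by
  obtain ⟨C, -, hC⟩ := N.exists_norm_le_mul hN
  rw [tendsto_iff_norm_sub_tendsto_zero]
  have h1 := h.const_mul C
  rw [mul_zero] at h1
  exact squeeze_zero (fun n => norm_nonneg _) (fun n => hC _) h1

theorem theorem1 {d d₁ : ℕ} (N : Seminorm ℝ (Fin d → ℝ)) (hN : ∀ v, N v = 0 → v = 0)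
    (K : SAConstants) (hK : K.Admissible) :
    ∃ (C : ℝ) (k : ℕ), 0 < C ∧
      ∀ (Y : Type*) [Fintype Y] [DecidableEq Y] (S : SAModel d d₁ Y), S.Assumptions N K →
      ∀ (Ω : Type*) [mΩ : MeasurableSpace Ω] (P : Measure Ω) [IsProbabilityMeasure P]
        (ℱ : Filtration ℕ mΩ) (ζ : ℕ → Ω → (Fin d₁ → ℝ)) (x : ℕ → Ω → (Fin d → ℝ))
        (y : ℕ → Ω → Y) (M : ℕ → Ω → (Fin d → ℝ)), S.IsRun K P ℱ ζ x y M →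
        (∀ δ : ℝ, 0 < δ →
          ENNReal.ofReal (1 - Real.pi ^ 2 * d / 6 * δ) ≤
            P {ω | ∀ n : ℕ, 1 ≤ n → N (x n ω - S.xStar) ≤
              C * (1 + Real.log n) ^ k * (Real.sqrt (Real.log ((n : ℝ) ^ 2 / δ) / n) *
                (n : ℝ) ^ (2 * K.κ₁ + max (K.𝔞 + K.κ₃) K.κ₂))}) ∧
        ∀ᵐ ω ∂P, Tendsto (fun n => x n ω) atTop (𝓝 S.xStar) := by
  rcases Nat.eq_zero_or_pos d with rfl | hd
  · refine ⟨1, 0, one_pos, fun Y _ _ S _ Ω _ P _ ℱ ζ x y M _ => ⟨fun δ _ => ?_, ?_⟩⟩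
    · refine (ENNReal.ofReal_le_ofReal (by simp : 1 - Real.pi ^ 2 * (0 : ℕ) / 6 * δ ≤ 1)).trans ?_
      rw [ENNReal.ofReal_one, ← measure_univ (μ := P)]
      refine measure_mono fun ω _ n _ => ?_
      rw [Subsingleton.elim (x n ω - S.xStar) 0, map_zero]
      positivity
    · exact .of_forall fun ω => by
        rw [show (fun n => x n ω) = fun _ => S.xStar from funext fun n => Subsingleton.elim _ _]
        exact tendsto_const_nhds
  obtain ⟨r, C, hr, hrt, hC, hmain⟩ := SAModel.exists_measure_not_le N hN K hK (d₁ := d₁) hd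
  refine ⟨C, 0, hC, fun Y _ _ S hS Ω _ P _ ℱ ζ x y M hR => ⟨fun δ hδ => ?_, ?_⟩⟩
  · rcases le_or_gt 1 (Real.pi ^ 2 * d / 6 * δ) with h1 | h1
    · rw [ENNReal.ofReal_of_nonpos (by linarith)]
      exact zero_le
    have h2 := hmain Y S hS Ω P ℱ ζ x y M hR δ hδ h1
    set good := {ω | ∀ n : ℕ, 1 ≤ n → N (x n ω - S.xStar) ≤
      C * (Real.sqrt (Real.log ((n : ℝ) ^ 2 / δ)) * (n : ℝ) ^ (-r))} with hgood
    have h3 : ENNReal.ofReal (1 - Real.pi ^ 2 * d / 6 * δ) ≤ P good := by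
      rw [ENNReal.ofReal_sub _ (by positivity), ENNReal.ofReal_one, tsub_le_iff_right]
      calc (1 : ENNReal) = P Set.univ := measure_univ.symm
        _ ≤ P good + P goodᶜ := by
            rw [← Set.union_compl_self good]
            exact measure_union_le _ _
        _ ≤ _ := by gcongr; exact h2
    refine h3.trans (measure_mono fun ω hω n hn => (hω n hn).trans ?_)
    have hn' : (1 : ℝ) ≤ n := by exact_mod_cast hn
    have hn0 : (0 : ℝ) < n := by linarith
    rw [pow_zero, mul_one, Real.sqrt_div' _ hn0.le, div_mul_eq_mul_div, mul_div_assoc]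
    refine mul_le_mul_of_nonneg_left (mul_le_mul_of_nonneg_left ?_ (Real.sqrt_nonneg _)) hC.le
    rw [Real.sqrt_eq_rpow, ← Real.rpow_sub hn0]
    refine Real.rpow_le_rpow_of_exponent_le hn' ?_
    rw [SAConstants.driftExp] at hrt
    linarith
  -- The exceptional set for the bound contains the set where convergence fails, for every `δ`.
  · have hd' : (1 : ℝ) ≤ d := by exact_mod_cast hd
    have hc : 0 < Real.pi ^ 2 * d / 6 := by positivity
    have hle : ∀ t : ℝ, 0 < t → t < 1 →
        P {ω | ¬ Tendsto (fun n => x n ω) atTop (𝓝 S.xStar)} ≤ ENNReal.ofReal t := by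
      intro t ht ht1
      have hδt : Real.pi ^ 2 * d / 6 * (t / (Real.pi ^ 2 * d / 6)) = t := mul_div_cancel₀ _ hc.ne'
      have h2 := hmain Y S hS Ω P ℱ ζ x y M hR (t / (Real.pi ^ 2 * d / 6)) (div_pos ht hc)
        (by rw [hδt]; exact ht1)
      rw [hδt] at h2
      refine (measure_mono (Set.compl_subset_compl.2 fun ω hgood => ?_)).trans h2
      change ∀ n : ℕ, 1 ≤ n → _ at hgood
      change Tendsto _ _ _
      refine N.tendsto_of_tendsto_sub hN ?_
      have h3 := (tendsto_sqrt_log_mul_rpow_neg (div_pos ht hc) hr).const_mul C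
      rw [mul_zero] at h3
      exact squeeze_zero' (.of_forall fun n => apply_nonneg N _)
        (eventually_atTop.2 ⟨1, hgood⟩) h3
    rw [ae_iff]
    refine le_antisymm (ENNReal.le_of_forall_pos_le_add fun t ht _ => ?_) zero_le
    rw [zero_add]
    refine (hle (min t (1 / 2)) (by positivity) (by norm_num)).trans ?_
    exact (ENNReal.ofReal_le_ofReal (min_le_left _ _)).trans_eq (ENNReal.ofReal_coe_nnreal)
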